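/- Let $(m_j)_{j\ge1}$, $(n_j)_{j\ge 1}$ be given by $m_1=2^5$, $m_{j+1}=m_j^5$, $n_1=2^6$, $n_{j+1}=(2n_j)^{s_j}$, where $2^{s_j}=m_{j+1}^3$. Members $f$ of $c_{00}(\mathbb N)$ act on $c_{00}(\mathbb N)$ by $f(x)=\sum_n f(n)x(n)$. For $K\subset c_{00}(\mathbb N)$ and $j\ge1$, a result of an $(\mathcal A_{n_j},m_j^{-1})$-operation on $K$ is a functional $f=m_j^{-1}(g_1+\dots+g_d)$ with $d\le n_j$, $g_1,\dots,g_d\in K$ and $\operatorname{supp} g_1<\dots<\operatorname{supp} g_d$. We say that $K$ is closed under $\ell_2$-combinations if $\sum_{i=1}^d\lambda_i f_i\in K$ whenever $\lambda_i\in\mathbb Q$, $\sum_i\lambda_i^2\le1$, each $f_i\in K$ is a result of an $(\mathcal A_{n_{j_i}},m_{j_i}^{-1})$-operation on $K$, and the indices $j_i$ are distinct. The set $K$ is rationally convex if it contains all convex combinations with rational coefficients of its members. A ground set is a set $G\subset c_{00}(\mathbb N)$ that is symmetric, contains all $e_n^*$, is closed under restriction of its members to intervals of $\mathbb N$, and whose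 members have rational coefficients in $[-1,1]$. Let $\mathcal W_G$ be the smallest subset of $c_{00}(\mathbb N)$ that contains $G$, is symmetric, closed under restriction to intervals, closed under the $(\mathcal A_{n_j},m_j^{-1})$-operation for every $j\ge1$, closed under $\ell_2$-combinations, and rationally convex. An extension of $G$ is a set $D_G$ with $G\subset D_G\subset\mathcal W_G$ that is symmetric, closed under restriction to intervals, closed under the $(\mathcal A_{n_{2j}},m_{2j}^{-1})$-operation for every $j\ge1$, closed under $\ell_2$-combinations, and rationally convex. Let $X_G$ and $\mathcal Y_{D_G}$ be the completions of $c_{00}(\mathbb N)$ under the norms $\|x\|_G=\sup_{f\in G}f(x)$ and $\|x\|_{D_G}=\sup_{f\in D_G}f(x)$. A Banach space admits $\ell_p$, $1\le p<\infty$ (respectively $c_0$) as a spreading model if it contains a normalized basic sequence $(x_i)_{i\ge1}$ such that, for some $C\ge1$ and every finite $F\subset\mathbb N$ with $\#F\le\min F$, the sequence $(x_i)_{i\in F}$ is $C$-equivalent to the unit vector basis of $\ell_p^{\#F}$ (respectively $\ell_\infty^{\#F}$). Theorem. Let $G$ be a ground set such that $X_G$ does not admit $\ell_1$ as a spreading model.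 Then, for every extension $D_G$ of $G$, the space $\mathcal Y_{D_G}$ does not admit $c_0$ or any $\ell_p$, $1\le p<\infty$, as a spreading model. -/

import Mathlib

noncomputable section

namespace SpreadingModels

/-! ### Sequences of parameters -/

/-- `m_j = 2 ^ (5 ^ j)`, that is `m_1 = 2 ^ 5` and `m_{j+1} = m_j ^ 5`. Only `j ≥ 1` is used. -/
def mSeq (j : ℕ) : ℕ := 2 ^ (5 ^ j)

/-- The exponents `s_j`, determined by `2 ^ s_j = m_{j+1} ^ 3`. -/
def sSeq (j : ℕ) : ℕ := 3 * 5 ^ (j + 1)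

/-- `n_1 = 2 ^ 6` and `n_{j+1} = (2 n_j) ^ s_j` for `j ≥ 1`. The value at `0` is never used. -/
def nSeq : ℕ → ℕ
  | 0 => 1
  | 1 => 2 ^ 6
  | j + 2 => (2 * nSeq (j + 1)) ^ sSeq (j + 1)

theorem mSeq_one : mSeq 1 = 2 ^ 5 := rfl

theorem mSeq_succ (j : ℕ) : mSeq (j + 1) = mSeq j ^ 5 := by
  simp only [mSeq, pow_succ 5 j, pow_mul]

theorem two_pow_sSeq (j : ℕ) : 2 ^ sSeq j = mSeq (j + 1) ^ 3 := by
  rw [sSeq, mSeq, ← pow_mul, mul_comm]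

/-! ### Functionals on `c₀₀` -/

/-- The action `φ(x) = ∑ n, φ(n) x(n)` of `φ ∈ c₀₀` on `x ∈ c₀₀`. -/
def pairing (φ : ℕ →₀ ℝ) : (ℕ →₀ ℝ) →ₗ[ℝ] ℝ := Finsupp.linearCombination ℝ (fun n => φ n)

/-- The restriction of `f` to the interval `{a, …, b}` (empty if `b < a`). -/
def restrictInterval (a b : ℕ) (f : ℕ →₀ ℝ) : ℕ →₀ ℝ := f.filter (fun n => a ≤ n ∧ n ≤ b)

/-- `supp f_1 < supp f_2 < … < supp f_d`. -/
def Successive {d : ℕ} (f : Fin d → ℕ →₀ ℝ) : Prop :=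
  ∀ i k : Fin d, i < k → ∀ a ∈ (f i).support, ∀ b ∈ (f k).support, a < b

/-- `f` is the result of an `(𝒜_{n_j}, m_j⁻¹)`-operation on members of `K`:
`f = m_j⁻¹ (g_1 + ⋯ + g_d)` with `d ≤ n_j`, `g_i ∈ K` and `g_1 < ⋯ < g_d`. -/
def IsOperationResult (K : Set (ℕ →₀ ℝ)) (j : ℕ) (f : ℕ →₀ ℝ) : Prop :=
  ∃ d : ℕ, d ≤ nSeq j ∧ ∃ g : Fin d → ℕ →₀ ℝ,
    (∀ i, g i ∈ K) ∧ Successive g ∧ f = (mSeq j : ℝ)⁻¹ • ∑ i, g i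

/-! ### Closure properties of norming sets -/

def IsSymmetric (K : Set (ℕ →₀ ℝ)) : Prop := ∀ f ∈ K, -f ∈ K

def ClosedUnderIntervals (K : Set (ℕ →₀ ℝ)) : Prop :=
  ∀ f ∈ K, ∀ a b : ℕ, restrictInterval a b f ∈ K

/-- `K` is closed under the `(𝒜_{n_j}, m_j⁻¹)`-operation. -/
def ClosedUnderOperation (K : Set (ℕ →₀ ℝ)) (j : ℕ) : Prop :=
  ∀ f, IsOperationResult K j f → f ∈ K

/-- `K` contains `∑ λ_i f_i` whenever `(λ_i)` are rationals with `∑ λ_i² ≤ 1` and the `f_i` are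
weighted members of `K`, with distinct weights: `f_i ∈ K` is the result of an
`(𝒜_{n_{j_i}}, m_{j_i}⁻¹)`-operation on members of `K`, and the `j_i` (equivalently the `n_{j_i}`,
or the `m_{j_i}`) are distinct. -/
def ClosedUnderL2Combinations (K : Set (ℕ →₀ ℝ)) : Prop :=
  ∀ (d : ℕ) (f : Fin d → ℕ →₀ ℝ) (j : Fin d → ℕ) (c : Fin d → ℚ),
    (∀ i, 1 ≤ j i) → Function.Injective j →
    (∀ i, f i ∈ K ∧ IsOperationResult K (j i) (f i)) →
    ∑ i, c i ^ 2 ≤ 1 → ∑ i, (c i : ℝ) • f i ∈ K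

def RationallyConvex (K : Set (ℕ →₀ ℝ)) : Prop :=
  ∀ (d : ℕ) (f : Fin d → ℕ →₀ ℝ) (r : Fin d → ℚ),
    (∀ i, f i ∈ K) → (∀ i, 0 ≤ r i) → ∑ i, r i = 1 → ∑ i, (r i : ℝ) • f i ∈ K

/-! ### Ground sets and their extensions -/

structure IsGroundSet (G : Set (ℕ →₀ ℝ)) : Prop where
  symm : IsSymmetric G
  basis_mem : ∀ n, Finsupp.single n 1 ∈ G
  abs_le_one : ∀ φ ∈ G, ∀ n, |φ n| ≤ 1
  rational : ∀ φ ∈ G, ∀ n, ∃ q : ℚ, φ n = q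
  interval : ClosedUnderIntervals G

/-- The closure properties that define `𝒲_G`. -/
structure IsFullyClosed (G K : Set (ℕ →₀ ℝ)) : Prop where
  symm : IsSymmetric K
  interval : ClosedUnderIntervals K
  subset : G ⊆ K
  operation : ∀ j, 1 ≤ j → ClosedUnderOperation K j
  l2 : ClosedUnderL2Combinations K
  convex : RationallyConvex K

/-- `𝒲_G`, the smallest subset of `c₀₀` with the properties `IsFullyClosed G`. -/
def fullClosure (G : Set (ℕ →₀ ℝ)) : Set (ℕ →₀ ℝ) := ⋂₀ {K | IsFullyClosed G K}

/-- `D` is an extension of the ground set `G`. -/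
structure IsExtension (G D : Set (ℕ →₀ ℝ)) : Prop where
  subset_fullClosure : D ⊆ fullClosure G
  symm : IsSymmetric D
  interval : ClosedUnderIntervals D
  subset : G ⊆ D
  even_operation : ∀ j, 1 ≤ j → ClosedUnderOperation D (2 * j)
  l2 : ClosedUnderL2Combinations D
  convex : RationallyConvex D

/-! ### The Banach space with norming set `K` -/

/-- The seminorm `‖x‖_K = sup {|φ(x)| : φ ∈ K}` on `c₀₀`. (For a symmetric set `K` of functionals
with coefficients in `[-1, 1]`, see `isLUB_norm`.) -/
def normingSeminorm (K : Set (ℕ →₀ ℝ)) : Seminorm ℝ (ℕ →₀ ℝ) :=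
  ⨆ φ : K, (normSeminorm ℝ ℝ).comp (pairing φ)

/-- `c₀₀`, to be equipped with `‖·‖_K`. -/
def NormedC00 (_K : Set (ℕ →₀ ℝ)) : Type := ℕ →₀ ℝ

instance (K : Set (ℕ →₀ ℝ)) : AddCommGroup (NormedC00 K) :=
  inferInstanceAs (AddCommGroup (ℕ →₀ ℝ))

instance (K : Set (ℕ →₀ ℝ)) : Module ℝ (NormedC00 K) :=
  inferInstanceAs (Module ℝ (ℕ →₀ ℝ))

instance (K : Set (ℕ →₀ ℝ)) : SeminormedAddCommGroup (NormedC00 K) :=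
  fast_instance% (normingSeminorm K).toAddGroupSeminorm.toSeminormedAddCommGroup

instance (K : Set (ℕ →₀ ℝ)) : NormedSpace ℝ (NormedC00 K) where
  norm_smul_le a x := (map_smul_eq_mul (normingSeminorm K) a x).le

/-- The identity map of `c₀₀` onto `(c₀₀, ‖·‖_K)`. -/
def toNormedC00 (K : Set (ℕ →₀ ℝ)) : (ℕ →₀ ℝ) ≃ₗ[ℝ] NormedC00 K := LinearEquiv.refl ℝ (ℕ →₀ ℝ)

/-- The completion of `(c₀₀, ‖·‖_K)`: this is `X_G` for a ground set `K = G`, and `𝒴_{D_G}` for an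
extension `K = D_G`. -/
abbrev NormingSpace (K : Set (ℕ →₀ ℝ)) : Type := UniformSpace.Completion (NormedC00 K)

theorem pairing_apply (φ x : ℕ →₀ ℝ) : pairing φ x = ∑ n ∈ x.support, x n * φ n := by
  simp [pairing, Finsupp.linearCombination_apply, Finsupp.sum]

theorem pairing_neg (φ x : ℕ →₀ ℝ) : pairing (-φ) x = -pairing φ x := by
  simp [pairing_apply]

theorem abs_pairing_le {φ : ℕ →₀ ℝ} (h : ∀ n, |φ n| ≤ 1) (x : ℕ →₀ ℝ) :
    |pairing φ x| ≤ ∑ n ∈ x.support, |x n| := by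
  rw [pairing_apply]
  refine (Finset.abs_sum_le_sum_abs _ _).trans (Finset.sum_le_sum fun n _ => ?_)
  rw [abs_mul]
  exact mul_le_of_le_one_right (abs_nonneg _) (h n)

/-- `‖x‖_K = sup {φ(x) : φ ∈ K}` for a nonempty symmetric set `K` of functionals with coefficients
in `[-1, 1]`. -/
theorem isLUB_norm {K : Set (ℕ →₀ ℝ)} (hne : K.Nonempty) (hs : IsSymmetric K)
    (hb : ∀ φ ∈ K, ∀ n, |φ n| ≤ 1) (x : ℕ →₀ ℝ) :
    IsLUB {t | ∃ φ ∈ K, t = pairing φ x} ‖toNormedC00 K x‖ := by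
  have hbdd : BddAbove (Set.range fun φ : K => (normSeminorm ℝ ℝ).comp (pairing φ)) := by
    rw [Seminorm.bddAbove_range_iff]
    rintro y
    refine ⟨∑ n ∈ y.support, |y n|, ?_⟩
    rintro _ ⟨φ, rfl⟩
    exact abs_pairing_le (hb φ φ.2) y
  have hx : ‖toNormedC00 K x‖ = ⨆ φ : K, |pairing φ x| := Seminorm.iSup_apply hbdd
  have hbx : BddAbove (Set.range fun φ : K => |pairing φ x|) :=
    ⟨∑ n ∈ x.support, |x n|, by rintro _ ⟨φ, rfl⟩; exact abs_pairing_le (hb φ φ.2) x⟩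
  rw [hx]
  constructor
  · rintro _ ⟨φ, hφ, rfl⟩
    exact (le_abs_self _).trans (le_ciSup hbx ⟨φ, hφ⟩)
  · intro t ht
    have : Nonempty K := hne.to_subtype
    refine ciSup_le fun φ => abs_le'.2 ⟨ht ⟨φ, φ.2, rfl⟩, ht ⟨-φ, hs _ φ.2, ?_⟩⟩
    exact (pairing_neg _ _).symm

theorem IsGroundSet.isLUB_norm {G : Set (ℕ →₀ ℝ)} (hG : IsGroundSet G) (x : ℕ →₀ ℝ) :
    IsLUB {t | ∃ φ ∈ G, t = pairing φ x} ‖toNormedC00 G x‖ :=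
  SpreadingModels.isLUB_norm ⟨_, hG.basis_mem 0⟩ hG.symm hG.abs_le_one x

theorem abs_operationResult_le {K : Set (ℕ →₀ ℝ)} (hK : ∀ f ∈ K, ∀ n, |f n| ≤ 1) {j : ℕ}
    {f : ℕ →₀ ℝ} (hf : IsOperationResult K j f) (n : ℕ) : |f n| ≤ (mSeq j : ℝ)⁻¹ := by
  obtain ⟨d, -, g, hg, hs, rfl⟩ := hf
  have key : |∑ i, g i n| ≤ 1 := by
    by_cases h : ∃ i, g i n ≠ 0
    · obtain ⟨i, hi⟩ := h
      rw [Finset.sum_eq_single i]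
      · exact hK _ (hg i) n
      · intro k _ hki
        by_contra hk
        rcases lt_or_gt_of_ne hki with h | h
        · exact lt_irrefl n (hs k i h n (by simpa using hk) n (by simpa using hi))
        · exact lt_irrefl n (hs i k h n (by simpa using hi) n (by simpa using hk))
      · simp
    · push Not at h
      simp [h]
  simp only [Finsupp.smul_apply, Finsupp.finsetSum_apply, smul_eq_mul, abs_mul]
  rw [abs_of_nonneg (by positivity)]
  exact mul_le_of_le_one_right (by positivity) key

theorem inv_mSeq_le (j : ℕ) : (mSeq j : ℝ)⁻¹ ≤ (1 / 2) ^ (j + 1) := by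
  have h : j + 1 ≤ 5 ^ j := Nat.lt_pow_self (by norm_num)
  rw [mSeq, one_div, inv_pow]
  push_cast
  exact inv_anti₀ (by positivity) (pow_le_pow_right₀ (by norm_num) h)

/-- The functionals in `𝒲_G` have coefficients in `[-1, 1]`, so that `‖·‖_K` is finite for
`K ⊆ 𝒲_G`. -/
theorem IsGroundSet.abs_le_one_of_mem_fullClosure {G : Set (ℕ →₀ ℝ)} (hG : IsGroundSet G) :
    ∀ f ∈ fullClosure G, ∀ n, |f n| ≤ 1 := by
  have hcl : IsFullyClosed G {f | ∀ n, |f n| ≤ 1} := by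
    refine ⟨fun f hf n => by simpa using hf n, fun f hf a b n => ?_, hG.abs_le_one,
      fun j _ f hf n => ?_, fun d f j c _ hj hf hc n => ?_, fun d f r hf hr hsum n => ?_⟩
    · by_cases h : a ≤ n ∧ n ≤ b
      · simpa [restrictInterval, Finsupp.filter_apply, h] using hf n
      · simp [restrictInterval, h]
    · refine (abs_operationResult_le (fun _ h => h) hf n).trans ((inv_mSeq_le j).trans ?_)
      exact pow_le_one₀ (by norm_num) (by norm_num)
    · have hc1 : ∀ i, |(c i : ℝ)| ≤ 1 := by
        intro i
        have h1 : c i ^ 2 ≤ 1 :=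
          (Finset.single_le_sum (f := fun i => c i ^ 2) (fun i _ => sq_nonneg _)
            (Finset.mem_univ i)).trans hc
        have h2 : |c i| ≤ 1 := by rwa [sq_le_one_iff_abs_le_one] at h1
        exact_mod_cast h2
      have hsm : Summable fun k : ℕ => ((1 : ℝ) / 2) ^ (k + 1) := by
        simpa [pow_succ] using summable_geometric_two.mul_right ((1 : ℝ) / 2)
      calc |(∑ i, (c i : ℝ) • f i) n| = |∑ i, (c i : ℝ) * f i n| := by
            simp [Finsupp.finsetSum_apply]
        _ ≤ ∑ i, |(c i : ℝ) * f i n| := Finset.abs_sum_le_sum_abs _ _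
        _ ≤ ∑ i, ((1 : ℝ) / 2) ^ (j i + 1) := by
            refine Finset.sum_le_sum fun i _ => ?_
            rw [abs_mul]
            exact (mul_le_of_le_one_left (abs_nonneg _) (hc1 i)).trans
              ((abs_operationResult_le (fun _ h => h) (hf i).2 n).trans (inv_mSeq_le _))
        _ = ∑ k ∈ Finset.univ.map ⟨j, hj⟩, ((1 : ℝ) / 2) ^ (k + 1) := by simp
        _ ≤ ∑' k : ℕ, ((1 : ℝ) / 2) ^ (k + 1) :=
            hsm.sum_le_tsum _ fun _ _ => by positivity
        _ = 1 := by
            simp only [pow_succ]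
            rw [tsum_mul_right, tsum_geometric_two]
            norm_num
    · calc |(∑ i, (r i : ℝ) • f i) n| = |∑ i, (r i : ℝ) * f i n| := by
            simp [Finsupp.finsetSum_apply]
        _ ≤ ∑ i, |(r i : ℝ) * f i n| := Finset.abs_sum_le_sum_abs _ _
        _ ≤ ∑ i, (r i : ℝ) := by
            refine Finset.sum_le_sum fun i _ => ?_
            rw [abs_mul, abs_of_nonneg (by exact_mod_cast hr i)]
            exact mul_le_of_le_one_right (by exact_mod_cast hr i) (hf i n)
        _ = 1 := by exact_mod_cast hsum
  exact fun f hf => hf _ hcl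

theorem IsExtension.isLUB_norm {G D : Set (ℕ →₀ ℝ)} (hG : IsGroundSet G) (hD : IsExtension G D)
    (x : ℕ →₀ ℝ) : IsLUB {t | ∃ φ ∈ D, t = pairing φ x} ‖toNormedC00 D x‖ :=
  SpreadingModels.isLUB_norm ⟨_, hD.subset (hG.basis_mem 0)⟩ hD.symm
    (fun f hf => hG.abs_le_one_of_mem_fullClosure f (hD.subset_fullClosure hf)) x

/-! ### Spreading models -/

/-- A basic sequence: a Schauder basis of its closed linear span. -/
def IsBasicSequence {E : Type*} [NormedAddCommGroup E] [NormedSpace ℝ E] (x : ℕ → E) : Prop :=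
  ∃ b : SchauderBasis ℝ (Submodule.span ℝ (Set.range x)).topologicalClosure,
    ∀ n, (b n : E) = x n

/-- The Schreier family `𝒮_1` of the sets `F` with `#F ≤ min F`. As sequences are indexed here from
`0`, the index `i` stands for the `(i + 1)`-st term. -/
def schreier : Set (Finset ℕ) := {F | ∀ i ∈ F, F.card ≤ i + 1}

/-- The normalized basic sequence `(x_i)` generates an `ℓ_p`-spreading model (a `c₀`-spreading model
if `p = ∞`): for some `C ≥ 1` and all `F ∈ 𝒮_1`, the sequence `(x_i)_{i ∈ F}` is `C`-equivalent to
the unit vector basis of `ℓ_p^{#F}`. -/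
def GeneratesSpreadingModel {E : Type*} [NormedAddCommGroup E] [NormedSpace ℝ E]
    (p : ENNReal) (x : ℕ → E) : Prop :=
  (∀ i, ‖x i‖ = 1) ∧ IsBasicSequence x ∧
    ∃ C : ℝ, 1 ≤ C ∧ ∀ F ∈ schreier, ∀ a : F → ℝ,
      C⁻¹ * ‖WithLp.toLp p a‖ ≤ ‖∑ i, a i • x i‖ ∧ ‖∑ i, a i • x i‖ ≤ C * ‖WithLp.toLp p a‖

/-- `E` admits `ℓ_p` as a spreading model, `1 ≤ p < ∞`. -/
def AdmitsEllSpreadingModel (E : Type*) [NormedAddCommGroup E] [NormedSpace ℝ E]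
    (p : ENNReal) : Prop :=
  ∃ x : ℕ → E, GeneratesSpreadingModel p x

/-- `E` admits `c₀` as a spreading model. -/
def AdmitsC0SpreadingModel (E : Type*) [NormedAddCommGroup E] [NormedSpace ℝ E] : Prop :=
  ∃ x : ℕ → E, GeneratesSpreadingModel ⊤ x

end SpreadingModels

end

noncomputable section

namespace SpreadingModels

/-!
Let `(x_i)` generate a spreading model in the space normed by an extension `D`. Along a suitable
subsequence, the differences of successive pairs of terms are close to a block sequence and satisfy
estimates of the same kind.

For `c₀` and for `ℓ_p` with `p > 1`, the `(A_{n_j}, m_j⁻¹)`-operation gives the sum of `n_j` such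
blocks a norm of order at least `n_j / m_j`, against an upper estimate of order `n_j ^ (1 / p)`;
this fails for large `j`, since every power of `m_j` is eventually below `n_j`.

For `ℓ_1`, an upper bound `C` for the norms of a block sequence with a lower `ℓ_1` estimate can be
halved by passing to further blocks, which keep the same lower estimate; iterating this gives a
contradiction. Since `X_G` has no `ℓ_1` spreading model, the blocks may be taken small in the norm
of `G`. What remains is the action of the `ℓ_2`-combinations. The norms of a block with respect to
the functionals of weight `m_j`, `j ≥ 1`, form a sequence of `ℓ_2`-norm at most `C`; by compactness,
these sequences are almost orthogonal along a subsequence of blocks and outside a fixed finite set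
of weights, so that long averages have small tails. A functional of one of the finitely many
remaining weights splits a bounded number of blocks and acts on the others with the factor `m_j⁻¹`.
-/

/-! ### Norming seminorms and the pairing -/

/-- The members of `K` have coefficients in `[-1, 1]`, as those of a ground set and of its
extensions do. This makes `‖·‖_K` finite, so that `normingSeminorm K` is not a junk supremum. -/
def CoeffsLeOne (K : Set (ℕ →₀ ℝ)) : Prop := ∀ φ ∈ K, ∀ n, |φ n| ≤ 1

section NormingSeminorm

variable {K L : Set (ℕ →₀ ℝ)}

theorem CoeffsLeOne.normingSeminorm_apply (hb : CoeffsLeOne K) (x : ℕ →₀ ℝ) :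
    normingSeminorm K x = ⨆ φ : K, |pairing φ x| := by
  refine Seminorm.iSup_apply (Seminorm.bddAbove_range_iff.2 fun y => ?_)
  refine ⟨∑ n ∈ y.support, |y n|, ?_⟩
  rintro _ ⟨φ, rfl⟩
  exact abs_pairing_le (hb φ φ.2) y

theorem CoeffsLeOne.abs_pairing_le_normingSeminorm (hb : CoeffsLeOne K) {φ : ℕ →₀ ℝ} (hφ : φ ∈ K)
    (x : ℕ →₀ ℝ) : |pairing φ x| ≤ normingSeminorm K x := by
  rw [hb.normingSeminorm_apply]
  refine le_ciSup (f := fun φ : K => |pairing φ x|) ⟨∑ n ∈ x.support, |x n|, ?_⟩ ⟨φ, hφ⟩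
  rintro _ ⟨φ, rfl⟩
  exact abs_pairing_le (hb φ φ.2) x

theorem CoeffsLeOne.normingSeminorm_le (hb : CoeffsLeOne K) {x : ℕ →₀ ℝ} {B : ℝ} (hB : 0 ≤ B)
    (h : ∀ φ ∈ K, |pairing φ x| ≤ B) : normingSeminorm K x ≤ B := by
  rw [hb.normingSeminorm_apply]
  exact Real.iSup_le (fun φ => h φ φ.2) hB

theorem CoeffsLeOne.exists_lt_abs_pairing (hb : CoeffsLeOne K) {x : ℕ →₀ ℝ} {B : ℝ} (hB : 0 ≤ B)
    (h : B < normingSeminorm K x) : ∃ φ ∈ K, B < |pairing φ x| := by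
  by_contra! hc
  exact (hb.normingSeminorm_le hB hc).not_gt h

theorem CoeffsLeOne.mono (hb : CoeffsLeOne L) (h : K ⊆ L) : CoeffsLeOne K :=
  fun φ hφ => hb φ (h hφ)

theorem CoeffsLeOne.normingSeminorm_mono (hb : CoeffsLeOne L) (h : K ⊆ L) (x : ℕ →₀ ℝ) :
    normingSeminorm K x ≤ normingSeminorm L x :=
  (hb.mono h).normingSeminorm_le (apply_nonneg _ _)
    fun _ hφ => hb.abs_pairing_le_normingSeminorm (h hφ) x

theorem pairing_comm (φ x : ℕ →₀ ℝ) : pairing φ x = pairing x φ := by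
  have h : ∀ φ x : ℕ →₀ ℝ, pairing φ x = ∑ n ∈ φ.support ∪ x.support, x n * φ n := by
    intro φ x
    rw [pairing_apply]
    exact Finset.sum_subset Finset.subset_union_right fun n _ hn => by
      simp [Finsupp.notMem_support_iff.1 hn]
  rw [h, h, Finset.union_comm]
  exact Finset.sum_congr rfl fun n _ => mul_comm _ _

theorem pairing_smul (c : ℝ) (φ x : ℕ →₀ ℝ) : pairing (c • φ) x = c * pairing φ x := by
  rw [pairing_comm, map_smul, pairing_comm, smul_eq_mul]

theorem pairing_sum {ι : Type*} (s : Finset ι) (φ : ι → ℕ →₀ ℝ) (x : ℕ →₀ ℝ) :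
    pairing (∑ i ∈ s, φ i) x = ∑ i ∈ s, pairing (φ i) x := by
  rw [pairing_comm, map_sum]
  exact Finset.sum_congr rfl fun i _ => pairing_comm _ _

theorem pairing_sum_smul {ι : Type*} (s : Finset ι) (c : ι → ℝ) (φ : ι → ℕ →₀ ℝ) (x : ℕ →₀ ℝ) :
    pairing (∑ i ∈ s, c i • φ i) x = ∑ i ∈ s, c i * pairing (φ i) x := by
  simp only [pairing_sum, pairing_smul]

theorem pairing_single (φ : ℕ →₀ ℝ) (n : ℕ) (c : ℝ) : pairing φ (Finsupp.single n c) = c * φ n := by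
  rw [pairing, Finsupp.linearCombination_single, smul_eq_mul]

theorem pairing_filter (P : ℕ → Prop) [DecidablePred P] (φ x : ℕ →₀ ℝ) :
    pairing (φ.filter P) x = pairing φ (x.filter P) := by
  rw [pairing_apply, pairing_apply, Finsupp.support_filter, Finset.sum_filter]
  refine Finset.sum_congr rfl fun n _ => ?_
  by_cases h : P n <;> simp [h]

theorem pairing_eq_zero_of_disjoint {φ x : ℕ →₀ ℝ} (h : Disjoint φ.support x.support) :
    pairing φ x = 0 := by
  rw [pairing_apply]
  refine Finset.sum_eq_zero fun n hn => ?_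
  rw [Finsupp.notMem_support_iff.1 (Finset.disjoint_right.1 h hn), mul_zero]

theorem CoeffsLeOne.abs_apply_le_normingSeminorm (hb : CoeffsLeOne K) {n : ℕ}
    (hn : Finsupp.single n 1 ∈ K) (x : ℕ →₀ ℝ) : |x n| ≤ normingSeminorm K x := by
  have h := hb.abs_pairing_le_normingSeminorm hn x
  rwa [pairing_comm, pairing_single, one_mul] at h

theorem CoeffsLeOne.normingSeminorm_single_le (hb : CoeffsLeOne K) (n : ℕ) (c : ℝ) :
    normingSeminorm K (Finsupp.single n c) ≤ |c| := by
  refine hb.normingSeminorm_le (abs_nonneg _) fun φ hφ => ?_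
  rw [pairing_single, abs_mul]
  exact mul_le_of_le_one_right (abs_nonneg _) (hb φ hφ n)

theorem ClosedUnderIntervals.filter_lt_mem (hK : ClosedUnderIntervals K) {f : ℕ →₀ ℝ} (hf : f ∈ K)
    (N : ℕ) : f.filter (· < N) ∈ K := by
  rcases N with _ | N
  · convert hK f hf 1 0 using 1
    ext n
    simp only [restrictInterval, Finsupp.filter_apply]
    rw [if_neg (by lia), if_neg (by lia)]
  · convert hK f hf 0 N using 1
    ext n
    simp only [restrictInterval, Finsupp.filter_apply]
    exact if_congr (by lia) rfl rfl

theorem CoeffsLeOne.normingSeminorm_filter_lt_le (hb : CoeffsLeOne K) (hK : ClosedUnderIntervals K)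
    (N : ℕ) (x : ℕ →₀ ℝ) : normingSeminorm K (x.filter (· < N)) ≤ normingSeminorm K x := by
  refine hb.normingSeminorm_le (apply_nonneg _ _) fun φ hφ => ?_
  rw [← pairing_filter]
  exact hb.abs_pairing_le_normingSeminorm (hK.filter_lt_mem hφ N) x

end NormingSeminorm

/-! ### Every extension is closed under all operations -/

section AllOperations

variable {K : Set (ℕ →₀ ℝ)}

theorem ClosedUnderL2Combinations.zero_mem (hK : ClosedUnderL2Combinations K) : 0 ∈ K := by
  simpa using hK 0 Fin.elim0 Fin.elim0 Fin.elim0 (fun i => i.elim0) (fun i => i.elim0)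
    (fun i => i.elim0) (by simp)

theorem ClosedUnderL2Combinations.pair_mem (hK : ClosedUnderL2Combinations K) {f g : ℕ →₀ ℝ}
    {i j : ℕ} (hi : 1 ≤ i) (hj : 1 ≤ j) (hij : i ≠ j) (hf : f ∈ K) (hf' : IsOperationResult K i f)
    (hg : g ∈ K) (hg' : IsOperationResult K j g) {a b : ℚ} (hab : a ^ 2 + b ^ 2 ≤ 1) :
    (a : ℝ) • f + (b : ℝ) • g ∈ K := by
  have hinj : Function.Injective ![i, j] := by
    intro k l h
    fin_cases k <;> fin_cases l <;> simp_all
  simpa [Fin.sum_univ_two] using hK 2 ![f, g] ![i, j] ![a, b]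
    (by intro k; fin_cases k <;> simpa) hinj (by intro k; fin_cases k <;> simp [*])
    (by simpa [Fin.sum_univ_two])

theorem RationallyConvex.smul_mem (hK : RationallyConvex K) (h0 : 0 ∈ K) {f : ℕ →₀ ℝ} (hf : f ∈ K)
    {r : ℚ} (hr : 0 ≤ r) (hr1 : r ≤ 1) : (r : ℝ) • f ∈ K := by
  simpa [Fin.sum_univ_two] using hK 2 ![f, 0] ![r, 1 - r] (by intro i; fin_cases i <;> simpa)
    (by intro i; fin_cases i <;> simp [hr, hr1]) (by simp)

theorem RationallyConvex.isOperationResult_smul_sum (hK : RationallyConvex K) (h0 : 0 ∈ K)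
    {d j : ℕ} (hd : d ≤ nSeq j) {g : Fin d → ℕ →₀ ℝ} (hg : ∀ i, g i ∈ K) (hs : Successive g)
    {t : ℚ} (ht : 0 ≤ t) (ht' : t * mSeq j ≤ 1) : IsOperationResult K j ((t : ℝ) • ∑ i, g i) := by
  refine ⟨d, hd, fun i => ((t * mSeq j : ℚ) : ℝ) • g i,
    fun i => hK.smul_mem h0 (hg i) (by positivity) ht', fun i k hik a ha b hb => ?_, ?_⟩
  · exact hs i k hik a (Finsupp.support_smul ha) b (Finsupp.support_smul hb)
  · have hm : (mSeq j : ℝ) ≠ 0 := by simp [mSeq]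
    rw [← Finset.smul_sum, smul_smul]
    congr 1
    push_cast
    field_simp

theorem nSeq_le_succ {j : ℕ} (hj : 1 ≤ j) : nSeq j ≤ nSeq (j + 1) := by
  obtain ⟨i, rfl⟩ := Nat.exists_eq_add_of_le' hj
  change nSeq (i + 1) ≤ (2 * nSeq (i + 1)) ^ sSeq (i + 1)
  exact (Nat.le_mul_of_pos_left _ two_pos).trans (Nat.le_self_pow (by simp [sSeq]) _)

theorem mem_of_add_mem {M : Type*} [AddCommGroup M] [LinearOrder M] [IsOrderedAddMonoid M]
    [Archimedean M] {A : Set M} {p q δ : M} (hq : q ∈ A) (hqp : q ≤ p) (hδ : 0 < δ)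
    (down : ∀ t ∈ A, ∀ u, q ≤ u → u ≤ t → u ∈ A)
    (grow : ∀ t ∈ A, q ≤ t → t ≤ p → t + δ ∈ A) : p ∈ A := by
  by_contra hp
  have hlt : ∀ t ∈ A, t ≤ p := fun t ht => by
    by_contra! h
    exact hp (down t ht p hqp h.le)
  have hmem : ∀ k : ℕ, q + k • δ ∈ A := by
    intro k
    induction k with
    | zero => simpa using hq
    | succ k ih =>
      rw [succ_nsmul, ← add_assoc]
      exact grow _ ih (le_add_of_nonneg_right (nsmul_nonneg hδ.le k)) (hlt _ ih)
  obtain ⟨k, hk⟩ := Archimedean.arch (p - q) hδ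
  have hpk : p ≤ q + k • δ := sub_le_iff_le_add'.1 hk
  exact hp (down _ (hmem k) p hqp hpk)

/-- The rotation with parameter `s = q / (2 p)` has rational sine and cosine. -/
theorem exists_rat_sq_add_sq_le_one {p q t : ℚ} (hq : 0 < q) (hqp : q ≤ p) (htp : t ≤ p) :
    ∃ a b : ℚ, a ^ 2 + b ^ 2 ≤ 1 ∧ t + q ^ 2 / (4 * p) ≤ a * t + b * q := by
  have hp : 0 < p := hq.trans_le hqp
  obtain ⟨s, hs⟩ : ∃ s : ℚ, s = q / (2 * p) := ⟨_, rfl⟩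
  have hs0 : 0 < s := by rw [hs]; positivity
  have hs1 : s ≤ 1 := by rw [hs, div_le_one (by positivity)]; linarith
  have hqs : q = 2 * p * s := by rw [hs]; field_simp
  have hδ : q ^ 2 / (4 * p) = p * s ^ 2 := by rw [hqs]; field_simp; ring
  have hpos : 0 < 1 + s ^ 2 := by positivity
  refine ⟨(1 - s ^ 2) / (1 + s ^ 2), 2 * s / (1 + s ^ 2), ?_, ?_⟩
  · rw [div_pow, div_pow, ← add_div, div_le_one (by positivity)]
    exact le_of_eq (by ring)
  · rw [div_mul_eq_mul_div, div_mul_eq_mul_div, ← add_div, le_div_iff₀ hpos, hδ, hqs]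
    have h1 : 0 ≤ s ^ 2 * (p - t) := mul_nonneg (sq_nonneg _) (by linarith)
    have h2 : 0 ≤ p * s ^ 2 * (1 - s ^ 2) := mul_nonneg (by positivity) (by nlinarith)
    nlinarith

/-- A multiple `t (g_1 + ⋯ + g_d)` with `t ≤ m_j⁻¹` is also a result of an operation with index `j`.
Combining it in `ℓ_2` with a result of index `j + 1` makes `t` grow until it reaches `m_j⁻¹`. -/
theorem closedUnderOperation_of_succ (hl2 : ClosedUnderL2Combinations K)
    (hconv : RationallyConvex K) {j : ℕ} (hj : 1 ≤ j) (hop : ClosedUnderOperation K (j + 1)) :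
    ClosedUnderOperation K j := by
  rintro _ ⟨d, hd, g, hg, hs, rfl⟩
  have hm : ∀ k, (0 : ℚ) < mSeq k := fun k => by simp [mSeq]
  set p : ℚ := (mSeq j : ℚ)⁻¹ with hp
  set q : ℚ := (mSeq (j + 1) : ℚ)⁻¹
  have hp0 : 0 < p := inv_pos.2 (hm _)
  have hq0 : 0 < q := inv_pos.2 (hm _)
  have hqp : q ≤ p := inv_anti₀ (hm _) <| by
    rw [mSeq_succ]
    exact_mod_cast Nat.le_self_pow (by norm_num) _
  have hres : ∀ {k : ℕ} {t : ℚ}, d ≤ nSeq k → 0 ≤ t → t ≤ (mSeq k : ℚ)⁻¹ →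
      IsOperationResult K k ((t : ℝ) • ∑ i, g i) := fun hdk ht htk =>
    hconv.isOperationResult_smul_sum hl2.zero_mem hdk hg hs ht
      ((le_inv_mul_iff₀' (hm _)).1 (by simpa using htk))
  have hqres := hres (hd.trans (nSeq_le_succ hj)) hq0.le le_rfl
  set A : Set ℚ := {t | (t : ℝ) • ∑ i, g i ∈ K}
  have hqA : q ∈ A := hop _ hqres
  have down : ∀ t ∈ A, ∀ u, q ≤ u → u ≤ t → u ∈ A := by
    intro t ht u hqu hut
    have ht0 : 0 < t := hq0.trans_le (hqu.trans hut)
    have hmem := hconv.smul_mem hl2.zero_mem ht (div_nonneg (hq0.le.trans hqu) ht0.le)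
      ((div_le_one ht0).2 hut)
    rwa [smul_smul, ← Rat.cast_mul, div_mul_cancel₀ _ ht0.ne'] at hmem
  have grow : ∀ t ∈ A, q ≤ t → t ≤ p → t + q ^ 2 / (4 * p) ∈ A := by
    intro t ht hqt htp
    obtain ⟨a, b, hab, hle⟩ := exists_rat_sq_add_sq_le_one hq0 hqp htp
    have hmem := hl2.pair_mem hj (Nat.le_add_left 1 j) (Nat.lt_succ_self j).ne ht
      (hres hd (hq0.le.trans hqt) htp) hqA hqres hab
    rw [smul_smul, smul_smul, ← add_smul, ← Rat.cast_mul, ← Rat.cast_mul, ← Rat.cast_add] at hmem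
    exact down _ hmem _ (hqt.trans (le_add_of_nonneg_right (by positivity))) hle
  have hpA : p ∈ A := mem_of_add_mem hqA hqp (by positivity) down grow
  simpa [A, hp] using hpA

theorem IsExtension.isFullyClosed {G D : Set (ℕ →₀ ℝ)} (hD : IsExtension G D) :
    IsFullyClosed G D where
  symm := hD.symm
  interval := hD.interval
  subset := hD.subset
  operation j hj := by
    rcases Nat.even_or_odd' j with ⟨k, rfl | rfl⟩
    · exact hD.even_operation k (by lia)
    · exact closedUnderOperation_of_succ hD.l2 hD.convex hj (hD.even_operation (k + 1) (by lia))
  l2 := hD.l2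
  convex := hD.convex

end AllOperations

/-! ### Block sequences are basic -/

section BasicSequences

variable {E : Type*} [NormedAddCommGroup E] [NormedSpace ℝ E]

open Filter Topology

theorem tendsto_of_mem_topologicalClosure_span {u : ℕ → E} {P : ℕ → E →L[ℝ] E}
    (hP : ∀ n x, ‖P n x‖ ≤ ‖x‖) (hPu : ∀ k, ∀ᶠ n in atTop, P n (u k) = u k) {x : E}
    (hx : x ∈ (Submodule.span ℝ (Set.range u)).topologicalClosure) :
    Tendsto (fun n => P n x) atTop (𝓝 x) := by
  have hequi : Equicontinuous fun n => ⇑(P n) :=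
    (LipschitzWith.uniformEquicontinuous _ 1 fun n =>
      AddMonoidHomClass.lipschitz_of_bound_nnnorm (P n) 1
        fun x => by simpa using! hP n x).equicontinuous
  have hclosed : IsClosed {x : E | Tendsto (fun n => P n x) atTop (𝓝 x)} :=
    hequi.isClosed_setOfPred_tendsto continuous_id
  refine closure_minimal (fun y hy => ?_) hclosed hx
  refine tendsto_nhds_of_eventually_eq ?_
  induction hy using Submodule.span_induction with
  | mem y hy => obtain ⟨k, rfl⟩ := hy; exact hPu k
  | zero => simp
  | add y z _ _ hy hz => filter_upwards [hy, hz] with n h₁ h₂ using by rw [map_add, h₁, h₂]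
  | smul a y _ hy => filter_upwards [hy] with n h using by rw [map_smul, h]

theorem exists_biorthogonal {u : ℕ → E} (hu : ∀ k, u k ≠ 0) {P : ℕ → E →L[ℝ] E}
    (hPu : ∀ n k, P n (u k) = if k < n then u k else 0) :
    ∃ g : ℕ → StrongDual ℝ E, ∀ i k, g i (u k) = if i = k then 1 else 0 := by
  choose g hg using fun k => SeparatingDual.exists_eq_one (R := ℝ) (hu k)
  refine ⟨fun i => (g i).comp (P (i + 1) - P i), fun i k => ?_⟩
  simp only [ContinuousLinearMap.comp_apply, _root_.sub_apply, hPu]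
  rcases lt_trichotomy i k with h | rfl | h
  · rw [if_neg (by lia), if_neg (by lia), if_neg (by lia), sub_zero, map_zero]
  · simp [hg]
  · rw [if_pos (by lia), if_pos (by lia), if_neg (by lia), sub_self, map_zero]

theorem isBasicSequence_of_projections {u : ℕ → E} (hu : ∀ k, u k ≠ 0) (P : ℕ → E →L[ℝ] E)
    (hP : ∀ n x, ‖P n x‖ ≤ ‖x‖) (hPu : ∀ n k, P n (u k) = if k < n then u k else 0) :
    IsBasicSequence u := by
  obtain ⟨g, hg⟩ := exists_biorthogonal hu hPu
  set V := (Submodule.span ℝ (Set.range u)).topologicalClosure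
  have huV : ∀ k, u k ∈ V := fun k =>
    Submodule.le_topologicalClosure _ (Submodule.subset_span ⟨k, rfl⟩)
  have hsum : ∀ n, ∀ x ∈ V, ∑ k ∈ Finset.range n, g k x • u k = P n x := by
    intro n x hx
    have h : Set.EqOn ⇑(∑ k ∈ Finset.range n, (g k).smulRight (u k)) (P n) (Set.range u) := by
      rintro _ ⟨j, rfl⟩
      simp [hg, hPu]
    simpa using ContinuousLinearMap.eqOn_closure_span h hx
  have hlim : ∀ x ∈ V, Tendsto (fun n => P n x) atTop (𝓝 x) := fun x hx =>
    tendsto_of_mem_topologicalClosure_span hP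
      (fun k => (eventually_gt_atTop k).mono fun n hn => by rw [hPu, if_pos hn]) hx
  refine ⟨⟨fun k => ⟨u k, huV k⟩, fun k => (g k).comp V.subtypeL, fun i j => ?_, fun x => ?_⟩,
    fun n => rfl⟩
  · simp [hg, Pi.single_apply]
  · rw [HasSum, SummationFilter.conditional_filter_eq_map_range, tendsto_map'_iff,
      tendsto_subtype_rng]
    refine (hlim x x.2).congr fun n => ?_
    simp [← hsum n x x.2]

end BasicSequences

/-- The map of `c₀₀` into its completion under `‖·‖_K`. -/
def toNormingSpace (K : Set (ℕ →₀ ℝ)) : (ℕ →₀ ℝ) →ₗ[ℝ] NormingSpace K :=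
  (UniformSpace.Completion.toComplₗᵢ (𝕜 := ℝ) (E := NormedC00 K)).toLinearMap ∘ₗ
    (toNormedC00 K).toLinearMap

theorem norm_toNormingSpace (K : Set (ℕ →₀ ℝ)) (x : ℕ →₀ ℝ) :
    ‖toNormingSpace K x‖ = normingSeminorm K x :=
  UniformSpace.Completion.norm_coe (toNormedC00 K x)

theorem exists_norm_toNormingSpace_sub_le (K : Set (ℕ →₀ ℝ)) (x : NormingSpace K) {ε : ℝ}
    (hε : 0 < ε) : ∃ y, ‖toNormingSpace K y - x‖ ≤ ε := by
  obtain ⟨y, hy⟩ := (UniformSpace.Completion.denseRange_coe (α := NormedC00 K)).exists_dist_lt x hε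
  refine ⟨(toNormedC00 K).symm y, ?_⟩
  rw [dist_comm, dist_eq_norm] at hy
  exact hy.le

section BlockSequences

variable {K : Set (ℕ →₀ ℝ)}

/-- The projection of `(c₀₀, ‖·‖_K)` onto the first `N` coordinates, a contraction. -/
def truncation (hb : CoeffsLeOne K) (hK : ClosedUnderIntervals K) (N : ℕ) :
    NormedC00 K →L[ℝ] NormedC00 K :=
  LinearMap.mkContinuous
    { toFun := fun x => toNormedC00 K (((toNormedC00 K).symm x).filter (· < N))
      map_add' := fun x y => by simp [Finsupp.filter_add]
      map_smul' := fun c x => by simp [Finsupp.filter_smul] } 1 fun x => by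
    rw [one_mul]
    exact hb.normingSeminorm_filter_lt_le hK N ((toNormedC00 K).symm x)

theorem norm_completion_truncation_le (hb : CoeffsLeOne K) (hK : ClosedUnderIntervals K) (N : ℕ)
    (x : NormingSpace K) : ‖(truncation hb hK N).completion x‖ ≤ ‖x‖ := by
  induction x using UniformSpace.Completion.induction_on with
  | hp => exact isClosed_le (by fun_prop) (by fun_prop)
  | ih x =>
    rw [ContinuousLinearMap.completion_apply_coe, UniformSpace.Completion.norm_coe,
      UniformSpace.Completion.norm_coe]
    exact hb.normingSeminorm_filter_lt_le hK N ((toNormedC00 K).symm x)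

theorem completion_truncation_toNormingSpace (hb : CoeffsLeOne K) (hK : ClosedUnderIntervals K)
    (N : ℕ) (x : ℕ →₀ ℝ) : (truncation hb hK N).completion (toNormingSpace K x) =
      toNormingSpace K (x.filter (· < N)) :=
  ContinuousLinearMap.completion_apply_coe _ _

/-- `supp w_0 < supp w_1 < …`. -/
def IsBlockSequence (w : ℕ → ℕ →₀ ℝ) : Prop :=
  ∀ k l, k < l → ∀ a ∈ (w k).support, ∀ b ∈ (w l).support, a < b

theorem IsBlockSequence.filter_lt_min' {w : ℕ → ℕ →₀ ℝ} (hw : IsBlockSequence w) {n : ℕ}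
    (hn : (w n).support.Nonempty) (k : ℕ) :
    (w k).filter (· < (w n).support.min' hn) = if k < n then w k else 0 := by
  have hmin := Finset.min'_mem _ hn
  split_ifs with h
  · refine (Finsupp.filter_eq_self_iff _ _).2 fun a ha => ?_
    exact hw k n h a (by simpa using ha) _ hmin
  · refine (Finsupp.filter_eq_zero_iff _ _).2 fun a ha => ?_
    by_contra hak
    have hak' : a ∈ (w k).support := by simpa using hak
    rcases (not_lt.1 h).eq_or_lt with rfl | h
    · exact (Finset.min'_le _ _ hak').not_gt ha
    · exact (hw n k h _ hmin a hak').not_gt ha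

theorem IsBlockSequence.isBasicSequence (hb : CoeffsLeOne K) (hK : ClosedUnderIntervals K)
    {w : ℕ → ℕ →₀ ℝ} (hw : IsBlockSequence w) (hne : ∀ k, normingSeminorm K (w k) ≠ 0) :
    IsBasicSequence fun k => toNormingSpace K (w k) := by
  have hsupp : ∀ k, (w k).support.Nonempty := fun k => by
    rw [Finsupp.support_nonempty_iff]
    intro h
    exact hne k (by rw [h, map_zero])
  refine isBasicSequence_of_projections (fun k h => hne k ?_)
    (fun n => (truncation hb hK ((w n).support.min' (hsupp n))).completion)
    (fun n x => norm_completion_truncation_le hb hK _ x) fun n k => ?_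
  · rw [← norm_toNormingSpace, h, norm_zero]
  · rw [completion_truncation_toNormingSpace, hw.filter_lt_min']
    split_ifs
    exacts [rfl, map_zero _]

end BlockSequences

/-! ### Block sequences near differences -/

/-- `1 ≤ i 0 < i' 0 < i 1 < i' 1 < ⋯`. The first inequality ensures that, in the difference sequence
`x (i k) - x (i' k)`, Schreier sets of indices involve Schreier sets of terms of `x`. -/
structure Interlacing (i i' : ℕ → ℕ) : Prop where
  pos : 0 < i 0
  lt : ∀ k, i k < i' k
  lt_succ : ∀ k, i' k < i (k + 1)

namespace Interlacing

variable {i i' : ℕ → ℕ}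

theorem strictMono_left (h : Interlacing i i') : StrictMono i :=
  strictMono_nat_of_lt_succ fun k => (h.lt k).trans (h.lt_succ k)

theorem strictMono_right (h : Interlacing i i') : StrictMono i' :=
  strictMono_nat_of_lt_succ fun k => (h.lt_succ k).trans (h.lt (k + 1))

theorem ne (h : Interlacing i i') (k l : ℕ) : i k ≠ i' l := by
  rcases le_or_gt k l with hkl | hkl
  · exact ((h.strictMono_left.monotone hkl).trans_lt (h.lt l)).ne
  · exact ((h.lt_succ l).trans_le (h.strictMono_left.monotone hkl)).ne'

theorem two_mul_lt (h : Interlacing i i') (k : ℕ) : 2 * k < i k := by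
  induction k with
  | zero => exact h.pos
  | succ k ih => have h₁ := h.lt k; have h₂ := h.lt_succ k; lia

theorem image_union_image_mem_schreier (h : Interlacing i i') {F : Finset ℕ} (hF : F ∈ schreier) :
    F.image i ∪ F.image i' ∈ schreier := by
  have hcard : (F.image i ∪ F.image i').card ≤ 2 * F.card := by
    have h₀ := Finset.card_union_le (F.image i) (F.image i')
    have h₁ := Finset.card_image_le (s := F) (f := i)
    have h₂ := Finset.card_image_le (s := F) (f := i')
    lia
  intro a ha
  obtain ⟨k, hk, hka⟩ : ∃ k ∈ F, i k ≤ a := by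
    rcases Finset.mem_union.1 ha with ha | ha <;> obtain ⟨k, hk, rfl⟩ := Finset.mem_image.1 ha
    exacts [⟨k, hk, le_rfl⟩, ⟨k, hk, (h.lt k).le⟩]
  have h₁ : F.card ≤ k + 1 := hF k hk
  have h₂ := h.two_mul_lt k
  lia

end Interlacing

theorem exists_lt_forall_abs_sub_le {t : ℕ → ℕ → ℝ} {C : ℝ} (ht : ∀ i n, |t i n| ≤ C) {η : ℝ}
    (hη : 0 < η) (M N : ℕ) : ∃ i ≥ M, ∃ i' > i, ∀ n < N, |t i n - t i' n| ≤ η := by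
  have hC : 0 ≤ C := (abs_nonneg _).trans (ht 0 0)
  obtain ⟨_, -, κ, hκ, hlim⟩ := tendsto_subseq_of_bounded
    (Metric.isBounded_closedBall (x := (0 : Fin N → ℝ)) (r := C)) (x := fun i n => t i n)
    fun i => mem_closedBall_zero_iff.2 ((pi_norm_le_iff_of_nonneg hC).2 fun n => ht i n)
  obtain ⟨k, hk⟩ := Metric.cauchySeq_iff.1 hlim.cauchySeq η hη
  set l := max k M
  refine ⟨κ l, (le_max_right k M).trans (hκ.id_le l), κ (l + 1), hκ l.lt_succ_self, fun n hn => ?_⟩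
  have hdist := hk l (le_max_left k M) (l + 1) ((le_max_left k M).trans l.le_succ)
  exact (dist_le_pi_dist _ _ (⟨n, hn⟩ : Fin N)).trans hdist.le

section NearDifferences

variable {K : Set (ℕ →₀ ℝ)}

theorem CoeffsLeOne.normingSeminorm_filter_lt_le_mul (hb : CoeffsLeOne K) {x : ℕ →₀ ℝ} {N : ℕ}
    {η : ℝ} (hη : ∀ n < N, |x n| ≤ η) : normingSeminorm K (x.filter (· < N)) ≤ N * η := by
  have hx : x.filter (· < N) = ∑ n ∈ Finset.range N, Finsupp.single n (x n) := by
    ext m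
    simp [Finsupp.filter_apply, Finsupp.finsetSum_apply, Finsupp.single_apply]
  calc normingSeminorm K (x.filter (· < N))
      ≤ ∑ n ∈ Finset.range N, normingSeminorm K (Finsupp.single n (x n)) := by
        rw [hx]
        exact Finset.le_sum_of_subadditive _ (map_zero _).le (map_add_le_add _) _ _
    _ ≤ ∑ _n ∈ Finset.range N, η := Finset.sum_le_sum fun n hn =>
        (hb.normingSeminorm_single_le n _).trans (hη n (Finset.mem_range.1 hn))
    _ = N * η := by simp

/-- Coordinates are continuous, so two terms of a bounded sequence can be chosen close on the first
`N` coordinates; deleting these from an approximation of the difference gives `w`. -/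
theorem exists_near_difference (hb : CoeffsLeOne K) (hbasis : ∀ n, Finsupp.single n 1 ∈ K)
    {x : ℕ → NormingSpace K} {B : ℝ} (hx : ∀ i, ‖x i‖ ≤ B) {ε : ℝ} (hε : 0 < ε) (M N : ℕ) :
    ∃ i ≥ M, ∃ i' > i, ∃ w : ℕ →₀ ℝ, (∀ a ∈ w.support, N ≤ a) ∧
      ‖toNormingSpace K w - (x i - x i')‖ ≤ ε := by
  choose y hy using fun i => exists_norm_toNormingSpace_sub_le K (x i) (div_pos hε four_pos)
  have hbd : ∀ i n, |y i n| ≤ ε / 4 + B := fun i n =>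
    calc |y i n| ≤ normingSeminorm K (y i) := hb.abs_apply_le_normingSeminorm (hbasis n) _
      _ = ‖toNormingSpace K (y i) - x i + x i‖ := by rw [sub_add_cancel, norm_toNormingSpace]
      _ ≤ ε / 4 + B := norm_add_le_of_le (hy i) (hx i)
  have hη : 0 < ε / (2 * (N + 1)) := by positivity
  obtain ⟨i, hi, i', hi', hclose⟩ := exists_lt_forall_abs_sub_le hbd hη M N
  set v := (y i - y i').filter (· < N) with hv
  have hvnorm : ‖toNormingSpace K v‖ ≤ ε / 2 := by
    rw [norm_toNormingSpace]
    refine (hb.normingSeminorm_filter_lt_le_mul hclose).trans ?_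
    rw [← mul_div_assoc, div_le_div_iff₀ (by positivity) two_pos]
    linarith
  refine ⟨i, hi, i', hi', (y i - y i') - v, fun a ha => ?_, ?_⟩
  · by_contra! haN
    simp [hv, haN] at ha
  · have hsplit : toNormingSpace K (y i - y i' - v) - (x i - x i') =
        (toNormingSpace K (y i) - x i) - (toNormingSpace K (y i') - x i') -
          toNormingSpace K v := by
      simp only [map_sub]
      abel
    rw [hsplit]
    refine (norm_sub_le_of_le (norm_sub_le_of_le (hy i) (hy i')) hvnorm).trans (le_of_eq ?_)
    ring

theorem exists_blockSequence_near_differences (hb : CoeffsLeOne K)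
    (hbasis : ∀ n, Finsupp.single n 1 ∈ K) {x : ℕ → NormingSpace K} {B : ℝ} (hx : ∀ i, ‖x i‖ ≤ B)
    {ε : ℝ} (hε : 0 < ε) :
    ∃ (i i' : ℕ → ℕ) (w : ℕ → ℕ →₀ ℝ), Interlacing i i' ∧ IsBlockSequence w ∧
      ∀ k, ‖toNormingSpace K (w k) - (x (i k) - x (i' k))‖ ≤ ε := by
  choose i hi i' hi' w hw hwε using fun M => exists_near_difference hb hbasis hx hε M M
  let next (M : ℕ) : ℕ := max (i' M) ((w M).support.sup id) + 1
  let M (k : ℕ) : ℕ := next^[k] 1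
  have hMsucc : ∀ k, M (k + 1) = next (M k) := fun k => Function.iterate_succ_apply' _ _ _
  have hi'M : ∀ k, i' (M k) < M (k + 1) := fun k => by
    rw [hMsucc]
    exact Nat.lt_succ_of_le (le_max_left _ _)
  have hwM : ∀ k, ∀ a ∈ (w (M k)).support, a < M (k + 1) := fun k a ha => by
    rw [hMsucc]
    exact Nat.lt_succ_of_le ((Finset.le_sup (f := id) ha).trans (le_max_right _ _))
  have hMmono : Monotone M := monotone_nat_of_le_succ fun k =>
    (hi _).trans ((hi' _).trans (hi'M k)).le
  refine ⟨fun k => i (M k), fun k => i' (M k), fun k => w (M k),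
    ⟨hi 1, fun k => hi' _, fun k => (hi'M k).trans_le (hi _)⟩, fun k l hkl a ha b hb' => ?_,
    fun k => hwε _⟩
  exact (hwM k a ha).trans_le ((hMmono hkl).trans (hw _ b hb'))

end NearDifferences

/-! ### Exclusion of `c₀` and of `ℓ_p` for `p > 1` -/

theorem two_pow_le_nSeq (j : ℕ) : 2 ^ j ≤ nSeq (j + 1) := by
  induction j with
  | zero => norm_num [nSeq]
  | succ j ih =>
    change 2 ^ (j + 1) ≤ (2 * nSeq (j + 1)) ^ sSeq (j + 1)
    calc 2 ^ (j + 1) = 2 * 2 ^ j := by ring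
      _ ≤ 2 * nSeq (j + 1) := by gcongr
      _ ≤ _ := Nat.le_self_pow (by simp [sSeq]) _

theorem nSeq_pos {j : ℕ} (hj : 1 ≤ j) : 0 < nSeq j := by
  obtain ⟨l, rfl⟩ := Nat.exists_eq_add_of_le' hj
  exact Nat.one_le_two_pow.trans (two_pow_le_nSeq l)

theorem mSeq_pow_le_nSeq (j : ℕ) : mSeq (j + 2) ^ (3 * (j + 1)) ≤ nSeq (j + 2) := by
  change _ ≤ (2 * nSeq (j + 1)) ^ sSeq (j + 1)
  calc mSeq (j + 2) ^ (3 * (j + 1)) = (2 ^ (j + 1)) ^ sSeq (j + 1) := by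
        rw [mSeq, sSeq, ← pow_mul, ← pow_mul]
        congr 1
        ring
    _ ≤ _ := by
        gcongr
        calc 2 ^ (j + 1) = 2 * 2 ^ j := by ring
          _ ≤ 2 * nSeq (j + 1) := by gcongr; exact two_pow_le_nSeq j

theorem lt_mSeq (j : ℕ) : j < mSeq j :=
  (Nat.lt_pow_self (by norm_num : 1 < 5)).trans (Nat.lt_pow_self (by norm_num))

theorem exists_mul_mSeq_lt_nSeq_rpow {α : ℝ} (hα : 0 < α) (B : ℝ) :
    ∃ j, 1 ≤ j ∧ B * mSeq j < (nSeq j : ℝ) ^ α := by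
  obtain ⟨k, hk⟩ := exists_nat_ge (max B (1 / α))
  refine ⟨k + 2, by lia, ?_⟩
  have hkm : (k : ℝ) < mSeq (k + 2) := by exact_mod_cast (lt_mSeq (k + 2)).trans' (by lia)
  have hm1 : (1 : ℝ) ≤ mSeq (k + 2) := by exact_mod_cast Nat.one_le_two_pow
  have hm0 : (0 : ℝ) < mSeq (k + 2) := by linarith
  have hexp : (2 : ℝ) ≤ (3 * (k + 1) : ℕ) * α := by
    have hkα : 1 ≤ k * α := (div_le_iff₀ hα).1 ((le_max_right _ _).trans hk)
    push_cast
    nlinarith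
  calc B * mSeq (k + 2) ≤ k * mSeq (k + 2) := by
        gcongr
        exact (le_max_left _ _).trans hk
    _ < (mSeq (k + 2) : ℝ) * mSeq (k + 2) := by gcongr
    _ = (mSeq (k + 2) : ℝ) ^ (2 : ℝ) := by norm_cast; ring
    _ ≤ (mSeq (k + 2) : ℝ) ^ ((3 * (k + 1) : ℕ) * α) := Real.rpow_le_rpow_of_exponent_le hm1 hexp
    _ = ((mSeq (k + 2) : ℝ) ^ (3 * (k + 1))) ^ α := by
        rw [Real.rpow_mul hm0.le, Real.rpow_natCast]
    _ ≤ (nSeq (k + 2) : ℝ) ^ α := by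
        refine Real.rpow_le_rpow (by positivity) ?_ hα.le
        exact_mod_cast mSeq_pow_le_nSeq k

theorem image_mem_schreier {F : Finset ℕ} (hF : F ∈ schreier) {f : ℕ → ℕ} (hf : StrictMono f) :
    F.image f ∈ schreier := by
  intro a ha
  obtain ⟨k, hk, rfl⟩ := Finset.mem_image.1 ha
  have h₁ : F.card ≤ k + 1 := hF k hk
  have h₂ : k ≤ f k := hf.le_apply
  exact Finset.card_image_le.trans (by lia)

theorem Ico_two_mul_mem_schreier (n : ℕ) : Finset.Ico n (2 * n) ∈ schreier := by
  intro k hk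
  have hnk := (Finset.mem_Ico.1 hk).1
  rw [Nat.card_Ico]
  lia

theorem pair_mem_schreier {k l : ℕ} (hk : 1 ≤ k) (hl : 1 ≤ l) : ({k, l} : Finset ℕ) ∈ schreier := by
  intro a ha
  have hcard : ({k, l} : Finset ℕ).card ≤ 2 := Finset.card_le_two
  simp only [Finset.mem_insert, Finset.mem_singleton] at ha
  lia

section SpreadingEstimates

variable {E : Type*} [NormedAddCommGroup E] [NormedSpace ℝ E]

/-- The estimates that define an `ℓ_p`-spreading model, with constant `C`. The coefficients are
indexed by `ℕ` instead of `F`. -/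
def HasSpreadingEstimates (C : ℝ) (p : ENNReal) (x : ℕ → E) : Prop :=
  ∀ F ∈ schreier, ∀ a : ℕ → ℝ,
    C⁻¹ * ‖WithLp.toLp p (fun i : F => a i)‖ ≤ ‖∑ i ∈ F, a i • x i‖ ∧
      ‖∑ i ∈ F, a i • x i‖ ≤ C * ‖WithLp.toLp p (fun i : F => a i)‖

theorem GeneratesSpreadingModel.exists_hasSpreadingEstimates {p : ENNReal} {x : ℕ → E}
    (hx : GeneratesSpreadingModel p x) : ∃ C : ℝ, 1 ≤ C ∧ HasSpreadingEstimates C p x := by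
  obtain ⟨-, -, C, hC, h⟩ := hx
  refine ⟨C, hC, fun F hF a => ?_⟩
  rw [← Finset.sum_coe_sort F fun i => a i • x i]
  exact h F hF fun i => a i

namespace HasSpreadingEstimates

variable {C : ℝ} {p : ENNReal} [Fact (1 ≤ p)] {x : ℕ → E}

theorem inv_le_norm_sub (hx : HasSpreadingEstimates C p x) (hC : 0 ≤ C) {k l : ℕ} (hk : 1 ≤ k)
    (hl : 1 ≤ l) (hkl : k ≠ l) : C⁻¹ ≤ ‖x k - x l‖ := by
  have hlow := (hx _ (pair_mem_schreier hk hl) fun n => if n = k then 1 else -1).1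
  rw [Finset.sum_pair hkl, if_pos rfl, if_neg hkl.symm, one_smul, neg_one_smul,
    ← sub_eq_add_neg] at hlow
  have hcoord := PiLp.norm_apply_le (p := p) (WithLp.toLp p
    (fun n : ({k, l} : Finset ℕ) => if (n : ℕ) = k then (1 : ℝ) else -1)) ⟨k, by simp⟩
  simp only [if_true, norm_one] at hcoord
  exact (le_mul_of_one_le_right (inv_nonneg.2 hC) hcoord).trans hlow

theorem norm_sum_le (hx : HasSpreadingEstimates C p x) {F : Finset ℕ} (hF : F ∈ schreier)
    (hne : F.Nonempty) : ‖∑ k ∈ F, x k‖ ≤ C * (F.card : ℝ) ^ (1 / p).toReal := by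
  have : Nonempty F := hne.to_subtype
  have hconst := PiLp.norm_toLp_const' (p := p) (ι := F) (1 : ℝ)
  rw [Fintype.card_coe, norm_one, mul_one] at hconst
  have hup := (hx F hF fun _ => 1).2
  simp only [one_smul] at hup
  exact hup.trans_eq (congrArg (C * ·) hconst)

theorem norm_sum_Ico_le (hx : HasSpreadingEstimates C p x) {n : ℕ} (hn : 0 < n) {f : ℕ → ℕ}
    (hf : StrictMono f) :
    ‖∑ k ∈ Finset.Ico n (2 * n), x (f k)‖ ≤ C * (n : ℝ) ^ (1 / p).toReal := by
  have hcard : ((Finset.Ico n (2 * n)).image f).card = n := by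
    rw [Finset.card_image_of_injective _ hf.injective, Nat.card_Ico]
    lia
  have h := hx.norm_sum_le (image_mem_schreier (Ico_two_mul_mem_schreier n) hf)
    (Finset.card_pos.1 (by lia))
  rwa [hcard, Finset.sum_image hf.injective.injOn] at h

theorem inv_le_norm_sub_of_interlacing (hx : HasSpreadingEstimates C p x) (hC : 0 ≤ C)
    {i i' : ℕ → ℕ} (hi : Interlacing i i') (k : ℕ) : C⁻¹ ≤ ‖x (i k) - x (i' k)‖ := by
  have hi1 : 1 ≤ i k := by have := hi.two_mul_lt k; lia
  exact hx.inv_le_norm_sub hC hi1 (hi1.trans (hi.lt k).le) (hi.lt k).ne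

theorem norm_sum_Ico_sub_le_of_interlacing (hx : HasSpreadingEstimates C p x) {n : ℕ} (hn : 0 < n)
    {i i' : ℕ → ℕ} (hi : Interlacing i i') :
    ‖∑ k ∈ Finset.Ico n (2 * n), (x (i k) - x (i' k))‖ ≤
      2 * (C * (n : ℝ) ^ (1 / p).toReal) := by
  rw [Finset.sum_sub_distrib, two_mul (C * _)]
  exact norm_sub_le_of_le (hx.norm_sum_Ico_le hn hi.strictMono_left)
    (hx.norm_sum_Ico_le hn hi.strictMono_right)

end HasSpreadingEstimates

end SpreadingEstimates

section NormingFunctionals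

variable {K : Set (ℕ →₀ ℝ)}

theorem CoeffsLeOne.exists_lt_pairing (hb : CoeffsLeOne K) (hs : IsSymmetric K) {x : ℕ →₀ ℝ}
    {c : ℝ} (hc : 0 ≤ c) (hx : c < normingSeminorm K x) : ∃ φ ∈ K, c < pairing φ x := by
  obtain ⟨φ, hφ, hφx⟩ := hb.exists_lt_abs_pairing hc hx
  rcases lt_abs.1 hφx with h | h
  · exact ⟨φ, hφ, h⟩
  · exact ⟨-φ, hs φ hφ, by rwa [pairing_neg]⟩

theorem CoeffsLeOne.exists_lt_pairing_of_supported (hb : CoeffsLeOne K) (hs : IsSymmetric K)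
    (hI : ClosedUnderIntervals K) {x : ℕ →₀ ℝ} {c : ℝ} (hc : 0 ≤ c) (hx : c < normingSeminorm K x) :
    ∃ φ ∈ K, c < pairing φ x ∧
      ∀ n ∈ φ.support, (∃ a ∈ x.support, a ≤ n) ∧ ∃ b ∈ x.support, n ≤ b := by
  obtain ⟨φ, hφ, hφx⟩ := hb.exists_lt_pairing hs hc hx
  have hne : x.support.Nonempty := by
    rw [Finsupp.support_nonempty_iff]
    rintro rfl
    rw [map_zero] at hφx
    linarith
  refine ⟨_, hI φ hφ (x.support.min' hne) (x.support.max' hne), ?_, fun n hn => ?_⟩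
  · rw [restrictInterval, pairing_filter, (Finsupp.filter_eq_self_iff _ _).2]
    · exact hφx
    · intro n hn
      have hn : n ∈ x.support := by simpa using hn
      exact ⟨Finset.min'_le _ _ hn, Finset.le_max' _ _ hn⟩
  · rw [restrictInterval, Finsupp.support_filter, Finset.mem_filter] at hn
    exact ⟨⟨_, Finset.min'_mem _ _, hn.2.1⟩, _, Finset.max'_mem _ _, hn.2.2⟩

theorem IsBlockSequence.isOperationResult {φ : ℕ → ℕ →₀ ℝ} (hφ : IsBlockSequence φ)
    (hK : ∀ k, φ k ∈ K) {j : ℕ} {F : Finset ℕ} (hF : F.card ≤ nSeq j) :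
    IsOperationResult K j ((mSeq j : ℝ)⁻¹ • ∑ k ∈ F, φ k) := by
  refine ⟨F.card, hF, fun i => φ (F.orderEmbOfFin rfl i), fun i => hK _,
    fun i k hik => hφ _ _ ((F.orderEmbOfFin rfl).strictMono hik), ?_⟩
  congr 1
  rw [← Finset.sum_coe_sort F]
  exact ((F.orderIsoOfFin rfl).toEquiv.sum_comp fun k : F => φ k).symm

theorem IsBlockSequence.le_normingSeminorm_sum (hb : CoeffsLeOne K) (hs : IsSymmetric K)
    (hI : ClosedUnderIntervals K) {j : ℕ} (hop : ClosedUnderOperation K j) {w : ℕ → ℕ →₀ ℝ}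
    (hw : IsBlockSequence w) {c : ℝ} (hc : 0 ≤ c) (hcw : ∀ k, c < normingSeminorm K (w k))
    {F : Finset ℕ} (hF : F.card ≤ nSeq j) :
    (mSeq j : ℝ)⁻¹ * (F.card * c) ≤ normingSeminorm K (∑ k ∈ F, w k) := by
  choose φ hφ hφw hφs using fun k => hb.exists_lt_pairing_of_supported hs hI hc (hcw k)
  have hblock : IsBlockSequence φ := by
    intro k l hkl a ha b hb
    obtain ⟨-, a', ha', haa⟩ := hφs k a ha
    obtain ⟨⟨b', hb', hbb⟩, -⟩ := hφs l b hb
    exact haa.trans_lt ((hw k l hkl a' ha' b' hb').trans_le hbb)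
  have hzero : ∀ k l, k ≠ l → pairing (φ k) (w l) = 0 := by
    intro k l hkl
    refine pairing_eq_zero_of_disjoint (Finset.disjoint_left.2 fun n hn hn' => ?_)
    obtain ⟨⟨a, ha, han⟩, b, hb, hnb⟩ := hφs k n hn
    rcases lt_or_gt_of_ne hkl with h | h
    · exact (hw k l h b hb n hn').not_ge hnb
    · exact (hw l k h n hn' a ha).not_ge han
  have hmem := hop _ (hblock.isOperationResult hφ hF)
  refine le_trans ?_ ((le_abs_self _).trans (hb.abs_pairing_le_normingSeminorm hmem _))
  rw [pairing_smul, pairing_sum]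
  gcongr
  rw [← nsmul_eq_mul]
  refine Finset.card_nsmul_le_sum _ _ _ fun k hk => ?_
  rw [map_sum, Finset.sum_eq_single_of_mem k hk fun l _ hl => hzero k l hl.symm]
  exact (hφw k).le

/-- The upper estimate for the differences, with error at most `C` from passing to the blocks,
against the lower estimate given by the operation with index `j`. -/
theorem HasSpreadingEstimates.nSeq_mul_inv_le (hb : CoeffsLeOne K)
    (hbasis : ∀ n, Finsupp.single n 1 ∈ K) (hs : IsSymmetric K) (hI : ClosedUnderIntervals K)
    {j : ℕ} (hop : ClosedUnderOperation K j) (hj : 1 ≤ j) {p : ENNReal} [Fact (1 ≤ p)]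
    {x : ℕ → NormingSpace K} {B C : ℝ} (hB : ∀ i, ‖x i‖ ≤ B) (hC : 1 ≤ C)
    (hx : HasSpreadingEstimates C p x) :
    (mSeq j : ℝ)⁻¹ * (nSeq j * (C⁻¹ / 2)) ≤ 3 * C * (nSeq j : ℝ) ^ (1 / p).toReal := by
  set n := nSeq j
  set F := Finset.Ico n (2 * n)
  have hn : 0 < n := nSeq_pos hj
  have hn1 : (1 : ℝ) ≤ n := by exact_mod_cast hn
  have hCinv : 0 < C⁻¹ := by positivity
  have hcard : F.card = n := by rw [Nat.card_Ico]; lia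
  obtain ⟨i, i', w, hi, hw, hnear⟩ := exists_blockSequence_near_differences hb hbasis hB
    (ε := C⁻¹ / (4 * n)) (by positivity)
  have hε : C⁻¹ / (4 * n) ≤ C⁻¹ / 4 := by gcongr; linarith
  have hlow : ∀ k, C⁻¹ / 2 < normingSeminorm K (w k) := by
    intro k
    have hdiff := hx.inv_le_norm_sub_of_interlacing (by linarith) hi k
    have htri := norm_sub_norm_le (x (i k) - x (i' k)) (toNormingSpace K (w k))
    rw [norm_sub_rev (x (i k) - x (i' k)), norm_toNormingSpace] at htri
    linarith [hnear k]
  have herr : ‖∑ k ∈ F, (toNormingSpace K (w k) - (x (i k) - x (i' k)))‖ ≤ C⁻¹ / 4 := by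
    refine (norm_sum_le_of_le _ fun k _ => hnear k).trans (le_of_eq ?_)
    rw [Finset.sum_const, hcard, nsmul_eq_mul]
    field_simp
  have hup : normingSeminorm K (∑ k ∈ F, w k) ≤ C⁻¹ / 4 + 2 * (C * (n : ℝ) ^ (1 / p).toReal) := by
    rw [← norm_toNormingSpace, map_sum]
    refine (norm_le_norm_add_norm_sub' _ (∑ k ∈ F, (x (i k) - x (i' k)))).trans ?_
    rw [← Finset.sum_sub_distrib, add_comm]
    exact add_le_add herr (hx.norm_sum_Ico_sub_le_of_interlacing hn hi)
  have hblock := hw.le_normingSeminorm_sum hb hs hI hop (by positivity) hlow hcard.le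
  rw [hcard] at hblock
  have hsmall : C⁻¹ / 4 ≤ C * (n : ℝ) ^ (1 / p).toReal :=
    calc C⁻¹ / 4 ≤ C * 1 := by linarith [inv_le_one_of_one_le₀ hC]
      _ ≤ _ := by gcongr; exact Real.one_le_rpow hn1 ENNReal.toReal_nonneg
  linarith

theorem not_generatesSpreadingModel_of_one_lt (hb : CoeffsLeOne K)
    (hbasis : ∀ n, Finsupp.single n 1 ∈ K) (hs : IsSymmetric K) (hI : ClosedUnderIntervals K)
    (hop : ∀ j, 1 ≤ j → ClosedUnderOperation K j) {p : ENNReal} (hp : 1 < p)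
    (x : ℕ → NormingSpace K) : ¬ GeneratesSpreadingModel p x := by
  intro hx
  have : Fact (1 ≤ p) := ⟨hp.le⟩
  obtain ⟨C, hC, hest⟩ := hx.exists_hasSpreadingEstimates
  set θ := (1 / p).toReal
  have hθ1 : θ < 1 := by
    have hp' : 1 / p < 1 := by rw [one_div]; exact ENNReal.inv_lt_one.2 hp
    exact (ENNReal.toReal_lt_toReal hp'.ne_top ENNReal.one_ne_top).2 hp'
  obtain ⟨j, hj, hbig⟩ := exists_mul_mSeq_lt_nSeq_rpow (sub_pos.2 hθ1) (6 * C ^ 2)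
  have hle := hest.nSeq_mul_inv_le hb hbasis hs hI (hop j hj) hj (fun i => (hx.1 i).le) hC
  have hm : (0 : ℝ) < mSeq j := by simp [mSeq]
  have hn : (0 : ℝ) < nSeq j := Nat.cast_pos.2 (nSeq_pos hj)
  refine hbig.not_ge ?_
  rw [Real.rpow_sub hn, Real.rpow_one, div_le_iff₀ (by positivity)]
  calc (nSeq j : ℝ) = (mSeq j : ℝ)⁻¹ * (nSeq j * (C⁻¹ / 2)) * (2 * C * mSeq j) := by field_simp
    _ ≤ 3 * C * (nSeq j : ℝ) ^ θ * (2 * C * mSeq j) := by gcongr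
    _ = 6 * C ^ 2 * mSeq j * (nSeq j : ℝ) ^ θ := by ring

end NormingFunctionals

/-! ### Lower `ℓ_1` estimates -/

section LowerEllOne

variable {V : Type*} [AddCommGroup V] [Module ℝ V] {q : Seminorm ℝ V} {w : ℕ → V} {c B ε : ℝ}

/-- In the seminorm `q`, the sequence `w` dominates `c` times the unit vector basis of `ℓ_1` on
Schreier sets. -/
def LowerEllOne (q : Seminorm ℝ V) (c : ℝ) (w : ℕ → V) : Prop :=
  ∀ F ∈ schreier, ∀ a : ℕ → ℝ, c * ∑ k ∈ F, |a k| ≤ q (∑ k ∈ F, a k • w k)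

namespace LowerEllOne

theorem le_apply (h : LowerEllOne q c w) (k : ℕ) : c ≤ q (w k) := by
  simpa using h {k} (fun i _ => by simp) fun _ => 1

theorem sub_of_interlacing (h : LowerEllOne q c w) {i i' : ℕ → ℕ} (hi : Interlacing i i') :
    LowerEllOne q (2 * c) fun k => w (i k) - w (i' k) := by
  intro F hF a
  have hinj := hi.strictMono_left.injective
  have hinj' := hi.strictMono_right.injective
  have hdisj : Disjoint (F.image i) (F.image i') := by
    refine Finset.disjoint_left.2 fun n hn hn' => ?_
    obtain ⟨k, -, rfl⟩ := Finset.mem_image.1 hn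
    obtain ⟨l, -, hl⟩ := Finset.mem_image.1 hn'
    exact hi.ne k l hl.symm
  set b : ℕ → ℝ := Function.extend i a (Function.extend i' (-a) 0)
  have hb : ∀ k, b (i k) = a k := hinj.extend_apply _ _
  have hb' : ∀ k, b (i' k) = -a k := fun k =>
    (Function.extend_apply' _ _ _ fun ⟨l, hl⟩ => hi.ne l k hl).trans (hinj'.extend_apply _ _ _)
  have hlow := h _ (hi.image_union_image_mem_schreier hF) b
  rw [Finset.sum_union hdisj, Finset.sum_union hdisj] at hlow
  simp only [Finset.sum_image hinj.injOn, Finset.sum_image hinj'.injOn, hb, hb', abs_neg,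
    neg_smul, ← Finset.sum_add_distrib, ← sub_eq_add_neg, ← smul_sub] at hlow
  rw [Finset.sum_add_distrib, ← two_mul] at hlow
  linarith

theorem of_near (h : LowerEllOne q c w) {v : ℕ → V} (hv : ∀ k, q (v k - w k) ≤ ε) :
    LowerEllOne q (c - ε) v := by
  intro F hF a
  have herr : q (∑ k ∈ F, a k • (v k - w k)) ≤ ε * ∑ k ∈ F, |a k| := by
    rw [Finset.mul_sum]
    refine (Finset.le_sum_of_subadditive _ (map_zero _).le (map_add_le_add _) _ _).trans
      (Finset.sum_le_sum fun k _ => ?_)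
    rw [map_smul_eq_mul, Real.norm_eq_abs, mul_comm]
    exact mul_le_mul_of_nonneg_right (hv k) (abs_nonneg _)
  have hsplit : ∑ k ∈ F, a k • w k =
      (∑ k ∈ F, a k • v k) - ∑ k ∈ F, a k • (v k - w k) := by
    rw [← Finset.sum_sub_distrib]
    exact Finset.sum_congr rfl fun k _ => by rw [smul_sub, sub_sub_cancel]
  have hlow := h F hF a
  rw [hsplit] at hlow
  linarith [hlow.trans (map_sub_le_add q _ _)]

theorem normalize (h : LowerEllOne q c w) (hc : 0 < c) (hB : ∀ k, q (w k) ≤ B) :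
    LowerEllOne q (c / B) fun k => (q (w k))⁻¹ • w k := by
  intro F hF a
  have hpos : ∀ k, 0 < q (w k) := fun k => hc.trans_le (h.le_apply k)
  simp only [smul_smul]
  refine le_trans ?_ (h F hF fun k => a k * (q (w k))⁻¹)
  rw [div_eq_mul_inv, mul_assoc, Finset.mul_sum]
  refine mul_le_mul_of_nonneg_left (Finset.sum_le_sum fun k _ => ?_) hc.le
  rw [abs_mul, abs_of_pos (inv_pos.2 (hpos k)), mul_comm]
  exact mul_le_mul_of_nonneg_left (inv_anti₀ (hpos k) (hB k)) (abs_nonneg _)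

theorem sum_smul (h : LowerEllOne q c w) {P : ℕ → Finset ℕ}
    (hdisj : Pairwise (Function.onFun Disjoint P))
    (hP : ∀ S ∈ schreier, S.biUnion P ∈ schreier) {a : ℕ → ℕ → ℝ}
    (ha : ∀ i, ∑ k ∈ P i, |a i k| = 1) : LowerEllOne q c fun i => ∑ k ∈ P i, a i k • w k := by
  intro S hS b
  set e : ℕ → ℝ := fun k => ∑ i ∈ S, if k ∈ P i then b i * a i k else 0
  have hek : ∀ i ∈ S, ∀ k ∈ P i, e k = b i * a i k := fun i hi k hk =>
    (Finset.sum_eq_single_of_mem i hi fun _ _ hji =>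
      if_neg (Finset.disjoint_left.1 (hdisj hji.symm) hk)).trans (if_pos hk)
  have habs : ∀ i ∈ S, ∑ k ∈ P i, |e k| = |b i| := fun i hi => by
    rw [Finset.sum_congr rfl fun k hk => by rw [hek i hi k hk, abs_mul], ← Finset.mul_sum, ha,
      mul_one]
  have hsum : ∀ i ∈ S, ∑ k ∈ P i, e k • w k = b i • ∑ k ∈ P i, a i k • w k := fun i hi => by
    rw [Finset.smul_sum]
    exact Finset.sum_congr rfl fun k hk => by rw [hek i hi k hk, mul_smul]
  have hlow := h _ (hP S hS) e
  rwa [Finset.sum_biUnion fun _ _ _ _ hij => hdisj hij,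
    Finset.sum_biUnion fun _ _ _ _ hij => hdisj hij, Finset.sum_congr rfl habs,
    Finset.sum_congr rfl hsum] at hlow

end LowerEllOne

/-- The combinations `∑_{k ∈ F} a_k w_k` with `∑ |a_k| = 1` of at most `n` terms of `w` whose
indices are at least `N`. -/
def ellOneCombinations (w : ℕ → V) (n N : ℕ) : Set V :=
  {v | ∃ (F : Finset ℕ) (a : ℕ → ℝ), F.card ≤ n ∧ (∀ k ∈ F, N ≤ k) ∧ ∑ k ∈ F, |a k| = 1 ∧
    v = ∑ k ∈ F, a k • w k}

theorem apply_le_of_mem_ellOneCombinations (hB : ∀ k, q (w k) ≤ B) {n N : ℕ} {v : V}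
    (hv : v ∈ ellOneCombinations w n N) : q v ≤ B := by
  obtain ⟨F, a, -, -, ha, rfl⟩ := hv
  calc q (∑ k ∈ F, a k • w k) ≤ ∑ k ∈ F, q (a k • w k) :=
        Finset.le_sum_of_subadditive _ (map_zero _).le (map_add_le_add _) _ _
    _ ≤ ∑ k ∈ F, |a k| * B := Finset.sum_le_sum fun k _ => by
        rw [map_smul_eq_mul, Real.norm_eq_abs]
        exact mul_le_mul_of_nonneg_left (hB k) (abs_nonneg _)
    _ = B := by rw [← Finset.sum_mul, ha, one_mul]

theorem sum_smul_comp_mem_ellOneCombinations {κ : ℕ → ℕ} (hκ : Function.Injective κ)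
    {F : Finset ℕ} {a : ℕ → ℝ} {N : ℕ} (hN : ∀ k ∈ F, N ≤ κ k) (ha : ∑ k ∈ F, |a k| = 1) :
    ∑ k ∈ F, a k • w (κ k) ∈ ellOneCombinations w F.card N := by
  refine ⟨F.image κ, Function.extend κ a 0, Finset.card_image_le, fun k hk => ?_, ?_, ?_⟩
  · obtain ⟨l, hl, rfl⟩ := Finset.mem_image.1 hk
    exact hN l hl
  · simpa only [Finset.sum_image hκ.injOn, hκ.extend_apply] using ha
  · simp only [Finset.sum_image hκ.injOn, hκ.extend_apply]

theorem exists_strictMono_lowerEllOne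
    (h : ∀ n, ∃ N, ∀ v ∈ ellOneCombinations w n N, ε ≤ q v) :
    ∃ κ : ℕ → ℕ, StrictMono κ ∧ LowerEllOne q ε (w ∘ κ) := by
  choose N hN using h
  obtain ⟨κ, hκ, hNκ⟩ := Filter.extraction_forall_of_eventually'
    (P := fun i k => ∀ n ∈ Finset.range (i + 2), N n ≤ k)
    fun i => ⟨(Finset.range (i + 2)).sup N, fun k hk n hn => (Finset.le_sup hn).trans hk⟩
  refine ⟨κ, hκ, fun F hF a => ?_⟩
  rcases (Finset.sum_nonneg fun k _ => abs_nonneg (a k) : 0 ≤ ∑ k ∈ F, |a k|).eq_or_lt with h0 | h0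
  · rw [← h0, mul_zero]
    exact apply_nonneg _ _
  have hmem := sum_smul_comp_mem_ellOneCombinations (w := w) hκ.injective (F := F)
    (a := fun k => (∑ l ∈ F, |a l|)⁻¹ * a k) (N := N F.card)
    (fun k hk => hNκ k _ (Finset.mem_range.2 (Nat.lt_succ_of_le (hF k hk)))) (by
      simp only [abs_mul, ← Finset.mul_sum]
      rw [abs_of_pos (inv_pos.2 h0), inv_mul_cancel₀ h0.ne'])
  have hlow := hN _ _ hmem
  simp only [mul_smul, ← Finset.smul_sum] at hlow
  rwa [map_smul_eq_mul, Real.norm_of_nonneg (inv_nonneg.2 h0.le), inv_mul_eq_div,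
    le_div_iff₀ h0] at hlow

end LowerEllOne

theorem generatesSpreadingModel_one_of_lowerEllOne {E : Type*} [NormedAddCommGroup E]
    [NormedSpace ℝ E] {x : ℕ → E} (hx : ∀ i, ‖x i‖ = 1) (hbasic : IsBasicSequence x) {c : ℝ}
    (hc : 0 < c) (hl : LowerEllOne (normSeminorm ℝ E) c x) : GeneratesSpreadingModel 1 x := by
  refine ⟨hx, hbasic, max 1 c⁻¹, le_max_left _ _, fun F hF a => ?_⟩
  obtain ⟨b, rfl⟩ : ∃ b : ℕ → ℝ, (fun i : F => b i) = a :=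
    ⟨Function.extend Subtype.val a 0, funext fun i => Subtype.val_injective.extend_apply _ _ _⟩
  have hnorm : ‖WithLp.toLp 1 fun i : F => b i‖ = ∑ i ∈ F, |b i| := by
    rw [PiLp.norm_eq_of_L1]
    exact Finset.sum_coe_sort F fun i => |b i|
  have hsum0 : 0 ≤ ∑ i ∈ F, |b i| := Finset.sum_nonneg fun _ _ => abs_nonneg _
  rw [hnorm, Finset.sum_coe_sort F fun i => b i • x i]
  constructor
  · refine (mul_le_mul_of_nonneg_right ?_ hsum0).trans (hl F hF b)
    exact inv_le_of_inv_le₀ hc (le_max_right _ _)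
  · calc ‖∑ i ∈ F, b i • x i‖ ≤ ∑ i ∈ F, |b i| := norm_sum_le_of_le _ fun i _ => by
          rw [norm_smul, hx, mul_one, Real.norm_eq_abs]
      _ ≤ max 1 c⁻¹ * ∑ i ∈ F, |b i| := le_mul_of_one_le_left hsum0 (le_max_left _ _)

theorem GeneratesSpreadingModel.exists_lowerEllOne {E : Type*} [NormedAddCommGroup E]
    [NormedSpace ℝ E] {x : ℕ → E} (hx : GeneratesSpreadingModel 1 x) :
    ∃ c : ℝ, 0 < c ∧ c ≤ 1 ∧ LowerEllOne (normSeminorm ℝ E) c x := by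
  obtain ⟨C, hC, hest⟩ := hx.exists_hasSpreadingEstimates
  refine ⟨C⁻¹, inv_pos.2 (one_pos.trans_le hC), inv_le_one_of_one_le₀ hC, fun F hF a => ?_⟩
  refine le_of_eq_of_le ?_ (hest F hF a).1
  rw [PiLp.norm_eq_of_L1]
  exact congrArg (C⁻¹ * ·) (Finset.sum_coe_sort F fun i => |a i|).symm

theorem lowerEllOne_normingSeminorm_iff {K : Set (ℕ →₀ ℝ)} {c : ℝ} {w : ℕ → ℕ →₀ ℝ} :
    LowerEllOne (normingSeminorm K) c w ↔
      LowerEllOne (normSeminorm ℝ (NormingSpace K)) c fun k => toNormingSpace K (w k) := by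
  simp only [LowerEllOne, coe_normSeminorm, ← map_smul, ← map_sum, norm_toNormingSpace]

theorem exists_mem_ellOneCombinations_lt {K : Set (ℕ →₀ ℝ)} (hb : CoeffsLeOne K)
    (hI : ClosedUnderIntervals K) (hX : ¬ AdmitsEllSpreadingModel (NormingSpace K) 1)
    {w : ℕ → ℕ →₀ ℝ} (hw : IsBlockSequence w) {B ε : ℝ} (hε : 0 < ε)
    (hB : ∀ k, normingSeminorm K (w k) ≤ B) :
    ∃ n : ℕ, ∀ N : ℕ, ∃ v ∈ ellOneCombinations w n N, normingSeminorm K v < ε := by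
  by_contra! hcon
  obtain ⟨κ, hκ, hl⟩ := exists_strictMono_lowerEllOne hcon
  have hpos : ∀ k, 0 < normingSeminorm K (w (κ k)) := fun k => hε.trans_le (hl.le_apply k)
  have hone : ∀ k, normingSeminorm K ((normingSeminorm K (w (κ k)))⁻¹ • w (κ k)) = 1 := fun k => by
    rw [map_smul_eq_mul, norm_inv, Real.norm_of_nonneg (hpos k).le, inv_mul_cancel₀ (hpos k).ne']
  have hblock : IsBlockSequence fun k => (normingSeminorm K (w (κ k)))⁻¹ • w (κ k) :=
    fun k l hkl a ha b hb => hw _ _ (hκ hkl) a (Finsupp.support_smul ha) b (Finsupp.support_smul hb)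
  exact hX ⟨_, generatesSpreadingModel_one_of_lowerEllOne
    (fun k => by rw [norm_toNormingSpace, hone])
    (hblock.isBasicSequence hb hI fun k => by simp [hone])
    (div_pos hε ((hpos 0).trans_le (hB _)))
    (lowerEllOne_normingSeminorm_iff.1 (hl.normalize hε fun k => hB (κ k)))⟩

section Blocks

theorem biUnion_mem_schreier {P : ℕ → Finset ℕ} {n : ℕ} (hcard : ∀ i, (P i).card ≤ n)
    (hP : ∀ i, ∀ k ∈ P i, n * (i + 1) ≤ k) {S : Finset ℕ} (hS : S ∈ schreier) :
    S.biUnion P ∈ schreier := by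
  intro k hk
  obtain ⟨i, hi, hki⟩ := Finset.mem_biUnion.1 hk
  calc (S.biUnion P).card ≤ S.card * n := Finset.card_biUnion_le_card_mul _ _ _ fun i _ => hcard i
    _ ≤ (i + 1) * n := Nat.mul_le_mul_right _ (hS i hi)
    _ = n * (i + 1) := mul_comm _ _
    _ ≤ k + 1 := (hP i k hki).trans k.le_succ

theorem IsBlockSequence.sum_smul {w : ℕ → ℕ →₀ ℝ} (hw : IsBlockSequence w) {P : ℕ → Finset ℕ}
    (hP : ∀ i j, i < j → ∀ k ∈ P i, ∀ l ∈ P j, k < l) (a : ℕ → ℕ → ℝ) :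
    IsBlockSequence fun i => ∑ k ∈ P i, a i k • w k := by
  have hmem : ∀ i, ∀ m ∈ (∑ k ∈ P i, a i k • w k).support, ∃ k ∈ P i, m ∈ (w k).support := by
    intro i m hm
    by_contra! h
    rw [Finsupp.mem_support_iff, Finsupp.finsetSum_apply] at hm
    refine hm (Finset.sum_eq_zero fun k hk => ?_)
    rw [Finsupp.smul_apply, Finsupp.notMem_support_iff.1 (h k hk), smul_zero]
  intro i j hij m hm m' hm'
  obtain ⟨k, hk, hmk⟩ := hmem i m hm
  obtain ⟨l, hl, hml⟩ := hmem j m' hm'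
  exact hw k l (hP i j hij k hk l hl) m hmk m' hml

/-- If the `i`-th block has at most `n` terms and starts after `n (i + 1)`, then the blocks with
indices in a Schreier set have their terms in a Schreier set. -/
theorem LowerEllOne.exists_blocks {q : Seminorm ℝ (ℕ →₀ ℝ)} {c : ℝ} {w : ℕ → ℕ →₀ ℝ}
    (hl : LowerEllOne q c w) (hw : IsBlockSequence w) {n : ℕ} {Q : Set (ℕ →₀ ℝ)}
    (h : ∀ N, ∃ v ∈ ellOneCombinations w n N, v ∈ Q) :
    ∃ v, IsBlockSequence v ∧ LowerEllOne q c v ∧ ∀ k, v k ∈ Q := by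
  choose _ hcomb hQ using h
  choose F a hcard hge ha heq using hcomb
  let next (N : ℕ) : ℕ := max (N + n) ((F N).sup id + 1)
  let N (i : ℕ) : ℕ := next^[i] n
  have hsucc : ∀ i, N (i + 1) = next (N i) := fun i => Function.iterate_succ_apply' _ _ _
  have hadd : ∀ i, N i + n ≤ N (i + 1) := fun i => (le_max_left _ _).trans_eq (hsucc i).symm
  have hlt : ∀ i, ∀ k ∈ F (N i), k < N (i + 1) := fun i k hk => by
    rw [hsucc]
    exact (Nat.lt_succ_of_le (Finset.le_sup (f := id) hk)).trans_le (le_max_right _ _)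
  have hmul : ∀ i, n * (i + 1) ≤ N i := fun i => by
    induction i with
    | zero => exact (mul_one n).le
    | succ i ih => exact (Nat.add_le_add_right ih n).trans (hadd i)
  have hmono : Monotone N := monotone_nat_of_le_succ fun i => (Nat.le_add_right _ n).trans (hadd i)
  have hconsec : ∀ i j, i < j → ∀ k ∈ F (N i), ∀ l ∈ F (N j), k < l :=
    fun i j hij k hk l hl => (hlt i k hk).trans_le ((hmono hij).trans (hge _ l hl))
  have hdisj : Pairwise (Function.onFun Disjoint fun i => F (N i)) :=
    (pairwise_disjoint_on _).2 fun i j hij =>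
      Finset.disjoint_left.2 fun k hk hk' => lt_irrefl k (hconsec i j hij k hk k hk')
  exact ⟨_, hw.sum_smul hconsec fun i => a (N i),
    hl.sum_smul hdisj (fun S => biUnion_mem_schreier (fun i => hcard _)
      fun i k hk => (hmul i).trans (hge _ k hk)) fun i => ha _,
    fun i => by rw [← heq]; exact hQ _⟩

end Blocks

/-! ### The action of `ℓ_2`-combinations -/

section WeightedFunctionals

variable {G K L : Set (ℕ →₀ ℝ)}

theorem restrictInterval_sum_smul {ι : Type*} (a b : ℕ) (s : Finset ι) (c : ι → ℝ)
    (f : ι → ℕ →₀ ℝ) :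
    restrictInterval a b (∑ i ∈ s, c i • f i) = ∑ i ∈ s, c i • restrictInterval a b (f i) := by
  ext n
  simp only [restrictInterval, Finsupp.filter_apply, Finsupp.finsetSum_apply, Finsupp.smul_apply]
  split_ifs <;> simp

theorem support_restrictInterval_subset (a b : ℕ) (f : ℕ →₀ ℝ) :
    (restrictInterval a b f).support ⊆ f.support := by
  rw [restrictInterval, Finsupp.support_filter]
  exact Finset.filter_subset _ _

theorem restrictInterval_restrictInterval (a b a' b' : ℕ) (f : ℕ →₀ ℝ) :
    restrictInterval a' b' (restrictInterval a b f) =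
      restrictInterval (max a a') (min b b') f := by
  ext n
  simp only [restrictInterval, Finsupp.filter_apply]
  split_ifs <;> first | rfl | (exfalso; lia)

theorem restrictInterval_zero_sup_support (f : ℕ →₀ ℝ) :
    restrictInterval 0 (f.support.sup id) f = f := by
  refine (Finsupp.filter_eq_self_iff _ _).2 fun n hn => ⟨n.zero_le, ?_⟩
  exact Finset.le_sup (f := id) (Finsupp.mem_support_iff.2 hn)

theorem IsOperationResult.restrictInterval (hI : ClosedUnderIntervals K) {j : ℕ} {f : ℕ →₀ ℝ}
    (hf : IsOperationResult K j f) (a b : ℕ) :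
    IsOperationResult K j (restrictInterval a b f) := by
  obtain ⟨d, hd, g, hg, hs, rfl⟩ := hf
  refine ⟨d, hd, fun i => SpreadingModels.restrictInterval a b (g i), fun i => hI _ (hg i) a b,
    fun i k hik m hm n hn => hs i k hik m (support_restrictInterval_subset a b _ hm) n
      (support_restrictInterval_subset a b _ hn), ?_⟩
  simpa only [Finset.smul_sum] using
    restrictInterval_sum_smul a b Finset.univ (fun _ => (mSeq j : ℝ)⁻¹) g

theorem IsOperationResult.mono (h : K ⊆ L) {j : ℕ} {f : ℕ →₀ ℝ} (hf : IsOperationResult K j f) :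
    IsOperationResult L j f := by
  obtain ⟨d, hd, g, hg, hs, rfl⟩ := hf
  exact ⟨d, hd, g, fun i => h (hg i), hs, rfl⟩

/-- The members of `K` of weight `m_{j+1}`, that is, those which are results of an
`(A_{n_{j+1}}, m_{j+1}⁻¹)`-operation on `K`. The shift makes all `j : ℕ` admissible. -/
def weightedFunctionals (K : Set (ℕ →₀ ℝ)) (j : ℕ) : Set (ℕ →₀ ℝ) :=
  {f | f ∈ K ∧ IsOperationResult K (j + 1) f}

theorem weightedFunctionals_subset (K : Set (ℕ →₀ ℝ)) (j : ℕ) : weightedFunctionals K j ⊆ K :=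
  fun _ hf => hf.1

theorem weightedFunctionals_mono (h : K ⊆ L) (j : ℕ) :
    weightedFunctionals K j ⊆ weightedFunctionals L j :=
  fun _ hf => ⟨h hf.1, hf.2.mono h⟩

theorem zero_mem_weightedFunctionals (h0 : 0 ∈ K) (j : ℕ) : 0 ∈ weightedFunctionals K j :=
  ⟨h0, 0, Nat.zero_le _, Fin.elim0, fun i => i.elim0, fun i => i.elim0, by simp⟩

/-- The `ℓ_2`-combinations of members of `K` with pairwise different weights. -/
def l2Combinations (K : Set (ℕ →₀ ℝ)) : Set (ℕ →₀ ℝ) :=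
  {φ | ∃ (S : Finset ℕ) (f : ℕ → ℕ →₀ ℝ) (c : ℕ → ℚ), (∀ j ∈ S, f j ∈ weightedFunctionals K j) ∧
    ∑ j ∈ S, c j ^ 2 ≤ 1 ∧ φ = ∑ j ∈ S, (c j : ℝ) • f j}

theorem weightedFunctionals_subset_l2Combinations (K : Set (ℕ →₀ ℝ)) (j : ℕ) :
    weightedFunctionals K j ⊆ l2Combinations K :=
  fun f hf => ⟨{j}, fun _ => f, fun _ => 1, by simpa using hf, by simp, by simp⟩

theorem l2Combinations_mono (h : K ⊆ L) : l2Combinations K ⊆ l2Combinations L := by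
  rintro _ ⟨S, f, c, hf, hc, rfl⟩
  exact ⟨S, f, c, fun j hj => weightedFunctionals_mono h j (hf j hj), hc, rfl⟩

theorem ClosedUnderIntervals.l2Combinations (hI : ClosedUnderIntervals K) :
    ClosedUnderIntervals (l2Combinations K) := by
  rintro _ ⟨S, f, c, hf, hc, rfl⟩ a b
  exact ⟨S, fun j => restrictInterval a b (f j), c,
    fun j hj => ⟨hI _ (hf j hj).1 a b, (hf j hj).2.restrictInterval hI a b⟩, hc,
    restrictInterval_sum_smul a b S _ f⟩

theorem sum_smul_mem_l2Combinations {d : ℕ} {f : Fin d → ℕ →₀ ℝ} {j : Fin d → ℕ} {c : Fin d → ℚ}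
    (hj : ∀ i, 1 ≤ j i) (hinj : Function.Injective j)
    (hf : ∀ i, f i ∈ K ∧ IsOperationResult K (j i) (f i)) (hc : ∑ i, c i ^ 2 ≤ 1) :
    ∑ i, (c i : ℝ) • f i ∈ l2Combinations K := by
  obtain ⟨k, rfl⟩ : ∃ k : Fin d → ℕ, j = fun i => k i + 1 :=
    ⟨fun i => j i - 1, funext fun i => (Nat.sub_add_cancel (hj i)).symm⟩
  have hk : Function.Injective k := fun i i' h => hinj (congrArg (· + 1) h)
  refine ⟨Finset.univ.map ⟨k, hk⟩, Function.extend k f 0, Function.extend k c 0, ?_, ?_, ?_⟩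
  · simpa [hk.extend_apply, weightedFunctionals] using hf
  · simpa [hk.extend_apply] using hc
  · simp [hk.extend_apply]

theorem ClosedUnderL2Combinations.l2Combinations_subset (hK : ClosedUnderL2Combinations K) :
    l2Combinations K ⊆ K := by
  rintro _ ⟨S, f, c, hf, hc, rfl⟩
  set e := S.equivFin.symm
  have hsum : ∀ {M : Type} [AddCommMonoid M] (g : ℕ → M), ∑ i, g (e i) = ∑ j ∈ S, g j :=
    fun g => (e.sum_comp fun j : S => g j).trans (Finset.sum_coe_sort S g)
  rw [← hsum fun j => (c j : ℝ) • f j]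
  exact hK S.card (fun i => f (e i)) (fun i => e i + 1) (fun i => c (e i)) (fun i => by lia)
    (fun i i' h => e.injective (Subtype.ext (Nat.succ_injective h)))
    (fun i => hf _ (e i).2) (by rwa [hsum fun j => c j ^ 2])

/-- The members of `K` all of whose restrictions to intervals are bounded by `B` at `x`. -/
def boundedRestrictions (K : Set (ℕ →₀ ℝ)) (x : ℕ →₀ ℝ) (B : ℝ) : Set (ℕ →₀ ℝ) :=
  {f | f ∈ K ∧ ∀ a b, |pairing (restrictInterval a b f) x| ≤ B}

theorem boundedRestrictions_subset (K : Set (ℕ →₀ ℝ)) (x : ℕ →₀ ℝ) (B : ℝ) :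
    boundedRestrictions K x B ⊆ K :=
  fun _ hf => hf.1

theorem CoeffsLeOne.mem_boundedRestrictions (hb : CoeffsLeOne L) (hI : ClosedUnderIntervals L)
    {f x : ℕ →₀ ℝ} (hfK : f ∈ K) (hfL : f ∈ L) {B : ℝ} (hB : normingSeminorm L x ≤ B) :
    f ∈ boundedRestrictions K x B :=
  ⟨hfK, fun a b => (hb.abs_pairing_le_normingSeminorm (hI f hfL a b) x).trans hB⟩

theorem RationallyConvex.boundedRestrictions (hK : RationallyConvex K) (x : ℕ →₀ ℝ) (B : ℝ) :
    RationallyConvex (boundedRestrictions K x B) := by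
  refine fun d f r hf hr hsum => ⟨hK d f r (fun i => (hf i).1) hr hsum, fun a b => ?_⟩
  rw [restrictInterval_sum_smul, pairing_sum_smul]
  calc |∑ i, (r i : ℝ) * pairing (restrictInterval a b (f i)) x|
      ≤ ∑ i, |(r i : ℝ) * pairing (restrictInterval a b (f i)) x| := Finset.abs_sum_le_sum_abs _ _
    _ ≤ ∑ i, (r i : ℝ) * B := Finset.sum_le_sum fun i _ => by
        have hri : (0 : ℝ) ≤ r i := by exact_mod_cast hr i
        rw [abs_mul, abs_of_nonneg hri]
        exact mul_le_mul_of_nonneg_left ((hf i).2 a b) hri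
    _ = B := by rw [← Finset.sum_mul, ← Rat.cast_sum, hsum, Rat.cast_one, one_mul]

theorem IsFullyClosed.boundedRestrictions (hK : IsFullyClosed G K) (hGI : ClosedUnderIntervals G)
    (hb : CoeffsLeOne K) {x : ℕ →₀ ℝ} {B : ℝ} (hG : normingSeminorm G x ≤ B)
    (hl2 : normingSeminorm (l2Combinations K) x ≤ B) :
    IsFullyClosed G (boundedRestrictions K x B) where
  symm f hf := by
    refine ⟨hK.symm f hf.1, fun a b => ?_⟩
    rw [restrictInterval, Finsupp.filter_neg, pairing_neg, abs_neg]
    exact hf.2 a b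
  interval f hf a b := by
    refine ⟨hK.interval f hf.1 a b, fun a' b' => ?_⟩
    rw [restrictInterval_restrictInterval]
    exact hf.2 _ _
  subset f hf := (hb.mono hK.subset).mem_boundedRestrictions hGI (hK.subset hf) hf hG
  operation j hj f hf := by
    obtain ⟨i, rfl⟩ := Nat.exists_eq_add_of_le' hj
    have hf' := hf.mono (boundedRestrictions_subset K x B)
    have hfK := hK.operation _ hj f hf'
    exact (hb.mono hK.l2.l2Combinations_subset).mem_boundedRestrictions hK.interval.l2Combinations
      hfK (weightedFunctionals_subset_l2Combinations K i ⟨hfK, hf'⟩) hl2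
  l2 d f j c hj hinj hf hc := by
    have hmem := l2Combinations_mono (boundedRestrictions_subset K x B)
      (sum_smul_mem_l2Combinations hj hinj hf hc)
    exact (hb.mono hK.l2.l2Combinations_subset).mem_boundedRestrictions hK.interval.l2Combinations
      (hK.l2.l2Combinations_subset hmem) hmem hl2
  convex := hK.convex.boundedRestrictions x B

theorem IsExtension.normingSeminorm_le_max (hK : IsExtension G K) (hGI : ClosedUnderIntervals G)
    (hb : CoeffsLeOne K) (x : ℕ →₀ ℝ) :
    normingSeminorm K x ≤ max (normingSeminorm G x) (normingSeminorm (l2Combinations K) x) := by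
  have hclosed := hK.isFullyClosed.boundedRestrictions hGI hb (x := x) (le_max_left _ _)
    (le_max_right _ _)
  refine hb.normingSeminorm_le (le_max_of_le_left (apply_nonneg _ x)) fun φ hφ => ?_
  simpa only [restrictInterval_zero_sup_support] using
    (hK.subset_fullClosure hφ _ hclosed).2 0 (φ.support.sup id)

end WeightedFunctionals

section SplitBlocks

variable {K : Set (ℕ →₀ ℝ)} {d : ℕ} {g : Fin d → ℕ →₀ ℝ}

/-- `x` is split after `g i`: its support meets that of `g i` and that of a later `g i'`. -/
def IsSplitAt (g : Fin d → ℕ →₀ ℝ) (x : ℕ →₀ ℝ) (i : Fin d) : Prop :=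
  ¬Disjoint (g i).support x.support ∧ ∃ i', i < i' ∧ ¬Disjoint (g i').support x.support

open Classical in
theorem IsBlockSequence.card_isSplitAt_le {w : ℕ → ℕ →₀ ℝ} (hw : IsBlockSequence w)
    (hg : Successive g) (F : Finset ℕ) : (F.filter fun k => ∃ i, IsSplitAt g (w k) i).card ≤ d := by
  have hunique : ∀ i k l, IsSplitAt g (w k) i → IsSplitAt g (w l) i → ¬k < l := by
    rintro i k l ⟨-, i', hii', hk⟩ ⟨hl, -⟩ hkl
    obtain ⟨a, ha, hak⟩ := Finset.not_disjoint_iff.1 hk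
    obtain ⟨b, hb, hbl⟩ := Finset.not_disjoint_iff.1 hl
    exact lt_asymm (hw k l hkl a hak b hbl) (hg i i' hii' b hb a ha)
  refine (Finset.card_le_card_of_forall_subsingleton (fun k i => IsSplitAt g (w k) i)
    (t := Finset.univ) (fun k hk => ?_) fun i _ k hk l hl => ?_).trans_eq (Finset.card_fin d)
  · simpa using (Finset.mem_filter.1 hk).2
  · exact le_antisymm (not_lt.1 (hunique i l k hl.2 hk.2)) (not_lt.1 (hunique i k l hk.2 hl.2))

theorem CoeffsLeOne.abs_pairing_sum_le_of_not_isSplitAt (hb : CoeffsLeOne K) (hg : ∀ i, g i ∈ K)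
    {x : ℕ →₀ ℝ} (hx : ∀ i, ¬IsSplitAt g x i) : |pairing (∑ i, g i) x| ≤ normingSeminorm K x := by
  rw [pairing_sum]
  by_cases hex : ∃ i, ¬Disjoint (g i).support x.support
  · obtain ⟨i, hi⟩ := hex
    rw [Finset.sum_eq_single_of_mem i (Finset.mem_univ _)]
    · exact hb.abs_pairing_le_normingSeminorm (hg i) x
    · intro i' _ hne
      refine pairing_eq_zero_of_disjoint (not_not.1 fun hi' => ?_)
      rcases hne.lt_or_gt with hlt | hlt
      · exact hx i' ⟨hi', i, hlt, hi⟩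
      · exact hx i ⟨hi, i', hlt, hi'⟩
  · push Not at hex
    rw [Finset.sum_eq_zero fun i _ => pairing_eq_zero_of_disjoint (hex i), abs_zero]
    exact apply_nonneg _ _

theorem CoeffsLeOne.sum_abs_pairing_le (hb : CoeffsLeOne K) {j : ℕ} {f : ℕ →₀ ℝ} (hfK : f ∈ K)
    (hf : IsOperationResult K j f) {w : ℕ → ℕ →₀ ℝ} (hw : IsBlockSequence w) {C : ℝ}
    (hC : ∀ k, normingSeminorm K (w k) ≤ C) (F : Finset ℕ) :
    ∑ k ∈ F, |pairing f (w k)| ≤ C * (F.card * (mSeq j : ℝ)⁻¹ + nSeq j) := by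
  classical
  have hC0 : 0 ≤ C := (apply_nonneg _ _).trans (hC 0)
  have hfw : ∀ k, |pairing f (w k)| ≤ C := fun k =>
    (hb.abs_pairing_le_normingSeminorm hfK _).trans (hC k)
  obtain ⟨d, hd, g, hg, hs, rfl⟩ := hf
  set split : ℕ → Prop := fun k => ∃ i, IsSplitAt g (w k) i
  have hcard : (F.filter split).card ≤ nSeq j := (hw.card_isSplitAt_le hs F).trans hd
  have hwhole : ∀ k, ¬split k → |pairing ((mSeq j : ℝ)⁻¹ • ∑ i, g i) (w k)| ≤ C * (mSeq j : ℝ)⁻¹ :=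
    fun k hk => by
      rw [pairing_smul, abs_mul, abs_of_nonneg (by positivity), mul_comm]
      have hle := hb.abs_pairing_sum_le_of_not_isSplitAt hg (not_exists.1 hk)
      exact mul_le_mul_of_nonneg_right (hle.trans (hC k)) (by positivity)
  calc ∑ k ∈ F, |pairing ((mSeq j : ℝ)⁻¹ • ∑ i, g i) (w k)|
      ≤ ∑ k ∈ F, (C * (mSeq j : ℝ)⁻¹ + if split k then C else 0) := by
        refine Finset.sum_le_sum fun k _ => ?_
        split_ifs with h
        · exact (hfw k).trans (le_add_of_nonneg_left (by positivity))
        · simpa only [add_zero] using hwhole k h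
    _ = F.card * (C * (mSeq j : ℝ)⁻¹) + (F.filter split).card * C := by
        rw [Finset.sum_add_distrib, Finset.sum_const, nsmul_eq_mul, ← Finset.sum_filter,
          Finset.sum_const, nsmul_eq_mul]
    _ ≤ F.card * (C * (mSeq j : ℝ)⁻¹) + nSeq j * C := by gcongr
    _ = C * (F.card * (mSeq j : ℝ)⁻¹ + nSeq j) := by ring

end SplitBlocks

section Duality

variable {K : Set (ℕ →₀ ℝ)}

theorem sum_sq_le_sq_of_forall_rat {ι : Type*} {S : Finset ι} {a : ι → ℝ} {N : ℝ}
    (h : ∀ c : ι → ℚ, ∑ i ∈ S, c i ^ 2 ≤ 1 → ∑ i ∈ S, (c i : ℝ) * a i ≤ N) :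
    ∑ i ∈ S, a i ^ 2 ≤ N ^ 2 := by
  by_contra! hlt
  have hN : 0 ≤ N := by simpa using h 0 (by simp)
  set A := ∑ i ∈ S, a i ^ 2
  have hA : 0 < A := (sq_nonneg N).trans_lt hlt
  have hsqrt : 0 < √A := Real.sqrt_pos.2 hA
  obtain ⟨s, hNs, hs⟩ : ∃ s, N / A < s ∧ s < 1 / √A := by
    refine exists_between ?_
    rw [div_lt_div_iff₀ hA hsqrt, one_mul]
    calc N * √A < √A * √A := mul_lt_mul_of_pos_right (Real.lt_sqrt_of_sq_lt hlt) hsqrt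
      _ = A := Real.mul_self_sqrt hA.le
  have hs0 : 0 ≤ s := (div_nonneg hN hA.le).trans hNs.le
  let U : Set (ι → ℝ) := {c | ∑ i ∈ S, c i ^ 2 < 1 ∧ N < ∑ i ∈ S, c i * a i}
  have hopen : IsOpen U := by
    refine IsOpen.and (isOpen_lt ?_ ?_) (isOpen_lt ?_ ?_) <;> fun_prop
  have hmem : (fun i => s * a i) ∈ U := by
    change ∑ i ∈ S, (s * a i) ^ 2 < 1 ∧ N < ∑ i ∈ S, s * a i * a i
    simp only [mul_pow, mul_assoc, ← sq, ← Finset.mul_sum]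
    refine ⟨?_, (div_lt_iff₀ hA).1 hNs⟩
    rw [lt_div_iff₀ hsqrt] at hs
    calc s ^ 2 * A = (s * √A) ^ 2 := by rw [mul_pow, Real.sq_sqrt hA.le]
      _ < 1 := pow_lt_one₀ (by positivity) hs two_ne_zero
  have hdense := DenseRange.piMap fun _ : ι => Rat.denseRange_cast (𝕜 := ℝ)
  obtain ⟨c, hc, hNc⟩ := hdense.exists_mem_open hopen ⟨_, hmem⟩
  simp only [Pi.map_apply] at hc hNc
  exact (h c (by exact_mod_cast hc.le)).not_gt hNc

theorem CoeffsLeOne.sum_sq_pairing_le (hb : CoeffsLeOne K) (hl2 : ClosedUnderL2Combinations K)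
    {S : Finset ℕ} {f : ℕ → ℕ →₀ ℝ} (hf : ∀ j ∈ S, f j ∈ weightedFunctionals K j) (x : ℕ →₀ ℝ) :
    ∑ j ∈ S, pairing (f j) x ^ 2 ≤ normingSeminorm K x ^ 2 := by
  refine sum_sq_le_sq_of_forall_rat fun c hc => ?_
  rw [← pairing_sum_smul]
  exact (le_abs_self _).trans
    (hb.abs_pairing_le_normingSeminorm (hl2.l2Combinations_subset ⟨S, f, c, hf, hc, rfl⟩) x)

theorem CoeffsLeOne.exists_mul_normingSeminorm_le (hb : CoeffsLeOne K) (h0 : 0 ∈ K) (x : ℕ →₀ ℝ)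
    {θ : ℝ} (hθ : θ ∈ Set.Ico 0 1) : ∃ φ ∈ K, θ * normingSeminorm K x ≤ |pairing φ x| := by
  rcases (apply_nonneg (normingSeminorm K) x).eq_or_lt with h | h
  · exact ⟨0, h0, by simp [← h]⟩
  · obtain ⟨φ, hφ, hlt⟩ := hb.exists_lt_abs_pairing (mul_nonneg hθ.1 h.le)
      (mul_lt_of_lt_one_left h hθ.2)
    exact ⟨φ, hφ, hlt.le⟩

theorem CoeffsLeOne.sum_sq_normingSeminorm_weightedFunctionals_le (hb : CoeffsLeOne K)
    (hl2 : ClosedUnderL2Combinations K) (S : Finset ℕ) {x : ℕ →₀ ℝ} {B : ℝ}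
    (hB : normingSeminorm K x ≤ B) :
    ∑ j ∈ S, normingSeminorm (weightedFunctionals K j) x ^ 2 ≤ B ^ 2 := by
  refine le_trans ?_ (pow_le_pow_left₀ (apply_nonneg _ _) hB 2)
  set t : ℕ → ℝ := fun j => normingSeminorm (weightedFunctionals K j) x
  have hθ : ∀ θ ∈ Set.Ico (0 : ℝ) 1, θ ^ 2 * ∑ j ∈ S, t j ^ 2 ≤ normingSeminorm K x ^ 2 := by
    intro θ hθ
    choose f hf hft using fun j => (hb.mono (weightedFunctionals_subset K j)
      ).exists_mul_normingSeminorm_le (zero_mem_weightedFunctionals hl2.zero_mem j) x hθ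
    refine le_trans ?_ (hb.sum_sq_pairing_le hl2 (S := S) (fun j _ => hf j) x)
    rw [Finset.mul_sum]
    refine Finset.sum_le_sum fun j _ => ?_
    rw [← mul_pow, ← sq_abs (pairing _ _)]
    exact pow_le_pow_left₀ (mul_nonneg hθ.1 (apply_nonneg _ _)) (hft j) 2
  have hlim : Filter.Tendsto (fun θ : ℝ => θ ^ 2 * ∑ j ∈ S, t j ^ 2) (nhdsWithin 1 (Set.Iio 1))
      (nhds (1 ^ 2 * ∑ j ∈ S, t j ^ 2)) :=
    Filter.Tendsto.mono_left (Continuous.tendsto (by fun_prop) 1) nhdsWithin_le_nhds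
  rw [one_pow, one_mul] at hlim
  exact le_of_tendsto hlim
    (Filter.mem_of_superset (Ico_mem_nhdsLT zero_lt_one) hθ)

end Duality

/-! ### Averages of bounded sequences in `ℓ_2` -/

section AlmostOrthogonal

theorem exists_tail_sum_sq_le {a : ℕ → ℝ} {B : ℝ} (h : ∀ S : Finset ℕ, ∑ j ∈ S, a j ^ 2 ≤ B)
    {δ : ℝ} (hδ : 0 < δ) :
    ∃ J : ℕ, ∀ S : Finset ℕ, (∀ j ∈ S, J ≤ j) → ∑ j ∈ S, a j ^ 2 ≤ δ := by
  have hsum : Summable fun j => a j ^ 2 := summable_of_sum_le (fun _ => sq_nonneg _) h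
  obtain ⟨s, hs⟩ := summable_iff_vanishing_norm.1 hsum δ hδ
  refine ⟨s.sup id + 1, fun S hS => ?_⟩
  refine (le_abs_self _).trans (hs S (Finset.disjoint_left.2 fun j hj hj' => ?_)).le
  exact (Nat.lt_succ_of_le (Finset.le_sup (f := id) hj')).not_ge (hS j hj)

theorem sum_mul_le_of_sum_sq_le {ι : Type*} {S : Finset ι} {a b : ι → ℝ} {A B : ℝ} (hA : 0 ≤ A)
    (hB : 0 ≤ B) (ha : ∑ j ∈ S, a j ^ 2 ≤ A ^ 2) (hb : ∑ j ∈ S, b j ^ 2 ≤ B ^ 2) :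
    ∑ j ∈ S, a j * b j ≤ A * B := by
  refine le_of_abs_le (abs_le_of_sq_le_sq ?_ (mul_nonneg hA hB))
  calc (∑ j ∈ S, a j * b j) ^ 2 ≤ (∑ j ∈ S, a j ^ 2) * ∑ j ∈ S, b j ^ 2 :=
        Finset.sum_mul_sq_le_sq_mul_sq _ _ _
    _ ≤ A ^ 2 * B ^ 2 := mul_le_mul ha hb (Finset.sum_nonneg fun _ _ => sq_nonneg _) (sq_nonneg _)
    _ = (A * B) ^ 2 := (mul_pow _ _ _).symm

variable {t : ℕ → ℕ → ℝ} {C η : ℝ}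

/-- Beyond `J` the limit `L` is small, so on every finite stretch beyond `J` the late terms of the
sequence are small as well, while the tail of `t r` is small after that stretch. -/
theorem exists_eventually_sum_mul_le (hC : 0 < C)
    (ht : ∀ k, ∀ S : Finset ℕ, ∑ j ∈ S, t k j ^ 2 ≤ C ^ 2) {L : ℕ → ℝ}
    (hL : Filter.Tendsto t Filter.atTop (nhds L)) (hη : 0 < η) :
    ∃ J : ℕ, ∀ r, ∀ᶠ k in Filter.atTop, ∀ S : Finset ℕ, (∀ j ∈ S, J ≤ j) →
      ∑ j ∈ S, t r j * t k j ≤ η := by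
  have hLsum : ∀ S : Finset ℕ, Filter.Tendsto (fun k => ∑ j ∈ S, t k j ^ 2) Filter.atTop
      (nhds (∑ j ∈ S, L j ^ 2)) := fun S =>
    tendsto_finsetSum _ fun j _ => (tendsto_pi_nhds.1 hL j).pow 2
  have hLC : ∀ S : Finset ℕ, ∑ j ∈ S, L j ^ 2 ≤ C ^ 2 := fun S =>
    le_of_tendsto' (hLsum S) fun k => ht k S
  obtain ⟨δ, hδ, hδη⟩ : ∃ δ > 0, C * (2 * δ) + δ * C = η :=
    ⟨η / (3 * C), by positivity, by field_simp; norm_num⟩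
  obtain ⟨J, hJ⟩ := exists_tail_sum_sq_le hLC (pow_pos hδ 2)
  refine ⟨J, fun r => ?_⟩
  obtain ⟨J', hJ'⟩ := exists_tail_sum_sq_le (ht r) (pow_pos hδ 2)
  have hlate : ∀ᶠ k in Filter.atTop, ∑ j ∈ Finset.Ico J J', t k j ^ 2 < (2 * δ) ^ 2 := by
    refine (hLsum _).eventually_lt_const ?_
    refine (hJ _ fun j hj => (Finset.mem_Ico.1 hj).1).trans_lt ?_
    exact pow_lt_pow_left₀ (by linarith) hδ.le two_ne_zero
  filter_upwards [hlate] with k hk S hS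
  rw [← Finset.sum_filter_add_sum_filter_not S (· < J')]
  have hhead : ∑ j ∈ S.filter (· < J'), t r j * t k j ≤ C * (2 * δ) := by
    refine sum_mul_le_of_sum_sq_le hC.le (by positivity) (ht r _) (le_trans ?_ hk.le)
    refine Finset.sum_le_sum_of_subset_of_nonneg (fun j hj => ?_) fun _ _ _ => sq_nonneg _
    rw [Finset.mem_filter] at hj
    exact Finset.mem_Ico.2 ⟨hS j hj.1, hj.2⟩
  have htail : ∑ j ∈ S.filter (¬ · < J'), t r j * t k j ≤ δ * C :=
    sum_mul_le_of_sum_sq_le hδ.le hC.le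
      (hJ' _ fun j hj => not_lt.1 (Finset.mem_filter.1 hj).2) (ht k _)
  exact (add_le_add hhead htail).trans_eq hδη

theorem exists_strictMono_sum_mul_le (hC : 0 < C)
    (ht : ∀ k, ∀ S : Finset ℕ, ∑ j ∈ S, t k j ^ 2 ≤ C ^ 2) (hη : 0 < η) :
    ∃ (J : ℕ) (κ : ℕ → ℕ), StrictMono κ ∧ ∀ k l, k < l → ∀ S : Finset ℕ, (∀ j ∈ S, J ≤ j) →
      ∑ j ∈ S, t (κ k) j * t (κ l) j ≤ η := by
  have hmem : ∀ k, t k ∈ Set.univ.pi fun _ => Set.Icc (-C) C := fun k j _ =>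
    abs_le.1 (abs_le_of_sq_le_sq (by simpa using ht k {j}) hC.le)
  obtain ⟨L, -, φ, hφ, hL⟩ :=
    (isCompact_univ_pi fun _ : ℕ => isCompact_Icc (a := -C) (b := C)).tendsto_subseq hmem
  obtain ⟨J, hJ⟩ := exists_eventually_sum_mul_le hC (fun k => ht (φ k)) hL hη
  obtain ⟨f, -, hf⟩ := exists_seq_of_forall_finset_exists (fun _ : ℕ => True)
    (fun r k => r < k ∧ ∀ S : Finset ℕ, (∀ j ∈ S, J ≤ j) → ∑ j ∈ S, t (φ r) j * t (φ k) j ≤ η)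
    fun s _ => by
      have hall : ∀ᶠ k in Filter.atTop, ∀ r ∈ s, r < k ∧ ∀ S : Finset ℕ, (∀ j ∈ S, J ≤ j) →
          ∑ j ∈ S, t (φ r) j * t (φ k) j ≤ η :=
        (Filter.eventually_all_finset s).2 fun r _ => (Filter.eventually_gt_atTop r).and (hJ r)
      exact hall.exists.imp fun k hk => ⟨trivial, hk⟩
  exact ⟨J, φ ∘ f, hφ.comp fun k l hkl => (hf k l hkl).1, fun k l hkl => (hf k l hkl).2⟩

theorem sum_sq_sum_le {ι : Type*} {S : Finset ι} {F : Finset ℕ} {t : ℕ → ι → ℝ}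
    (ht : ∀ k, ∑ j ∈ S, t k j ^ 2 ≤ C ^ 2) (hη : 0 ≤ η)
    (hcross : ∀ k l, k < l → ∑ j ∈ S, t k j * t l j ≤ η) :
    ∑ j ∈ S, (∑ k ∈ F, t k j) ^ 2 ≤ F.card * C ^ 2 + (F.card : ℝ) ^ 2 * η := by
  have hpair : ∀ k l, ∑ j ∈ S, t k j * t l j ≤ η + if k = l then C ^ 2 else 0 := by
    intro k l
    rcases lt_trichotomy k l with h | rfl | h
    · simpa only [h.ne, if_false, add_zero] using hcross k l h
    · simpa only [if_true, ← sq] using (ht k).trans (le_add_of_nonneg_left hη)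
    · simpa only [h.ne', if_false, add_zero, mul_comm] using hcross l k h
  calc ∑ j ∈ S, (∑ k ∈ F, t k j) ^ 2
      = ∑ k ∈ F, ∑ l ∈ F, ∑ j ∈ S, t k j * t l j := by
        simp only [sq, Finset.sum_mul_sum]
        rw [Finset.sum_comm]
        exact Finset.sum_congr rfl fun k _ => Finset.sum_comm
    _ ≤ ∑ k ∈ F, ∑ l ∈ F, (η + if k = l then C ^ 2 else 0) :=
        Finset.sum_le_sum fun k _ => Finset.sum_le_sum fun l _ => hpair k l
    _ = ∑ k ∈ F, (F.card * η + C ^ 2) := Finset.sum_congr rfl fun k hk => by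
        rw [Finset.sum_add_distrib, Finset.sum_const, nsmul_eq_mul, Finset.sum_ite_eq, if_pos hk]
    _ = F.card * C ^ 2 + (F.card : ℝ) ^ 2 * η := by
        rw [Finset.sum_const, nsmul_eq_mul]
        ring

end AlmostOrthogonal

section Averages

variable {G K : Set (ℕ →₀ ℝ)} {w : ℕ → ℕ →₀ ℝ} {C : ℝ}

theorem sum_inv_mSeq_succ_le (J : ℕ) : ∑ j ∈ Finset.range J, (mSeq (j + 1) : ℝ)⁻¹ ≤ 1 / 8 := by
  have hterm : ∀ j, (mSeq (j + 1) : ℝ)⁻¹ ≤ 1 / 16 * (1 / 2) ^ j := fun j => by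
    have hexp : j + 4 ≤ 5 ^ (j + 1) := by
      have : j < 5 ^ j := Nat.lt_pow_self (by norm_num)
      rw [pow_succ]
      lia
    rw [mSeq, Nat.cast_pow, Nat.cast_ofNat]
    calc ((2 : ℝ) ^ 5 ^ (j + 1))⁻¹ ≤ (2 ^ (j + 4))⁻¹ :=
          inv_anti₀ (by positivity) (pow_le_pow_right₀ (by norm_num) hexp)
      _ = 1 / 16 * (1 / 2) ^ j := by rw [pow_add, mul_inv, one_div_pow]; ring
  have hgeom : ∑ j ∈ Finset.range J, (1 / 2 : ℝ) ^ j ≤ 2 :=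
    (summable_geometric_two.sum_le_tsum _ fun j _ => by positivity).trans_eq tsum_geometric_two
  calc ∑ j ∈ Finset.range J, (mSeq (j + 1) : ℝ)⁻¹
      ≤ ∑ j ∈ Finset.range J, 1 / 16 * (1 / 2 : ℝ) ^ j := Finset.sum_le_sum fun j _ => hterm j
    _ ≤ 1 / 8 := by rw [← Finset.mul_sum]; linarith

theorem CoeffsLeOne.sum_low_weights_le (hb : CoeffsLeOne K) (hw : IsBlockSequence w)
    (hC : ∀ k, normingSeminorm K (w k) ≤ C) (F : Finset ℕ) {J : ℕ} {S : Finset ℕ}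
    (hS : S ⊆ Finset.range J) {f : ℕ → ℕ →₀ ℝ} (hf : ∀ j ∈ S, f j ∈ weightedFunctionals K j) :
    ∑ j ∈ S, ∑ k ∈ F, |pairing (f j) (w k)| ≤
      C * (F.card / 8 + ∑ j ∈ Finset.range J, (nSeq (j + 1) : ℝ)) := by
  have hC0 : 0 ≤ C := (apply_nonneg _ _).trans (hC 0)
  calc ∑ j ∈ S, ∑ k ∈ F, |pairing (f j) (w k)|
      ≤ ∑ j ∈ S, C * (F.card * (mSeq (j + 1) : ℝ)⁻¹ + nSeq (j + 1)) :=
        Finset.sum_le_sum fun j hj => hb.sum_abs_pairing_le (hf j hj).1 (hf j hj).2 hw hC F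
    _ ≤ ∑ j ∈ Finset.range J, C * (F.card * (mSeq (j + 1) : ℝ)⁻¹ + nSeq (j + 1)) :=
        Finset.sum_le_sum_of_subset_of_nonneg hS fun _ _ _ => by positivity
    _ = C * (F.card * (∑ j ∈ Finset.range J, (mSeq (j + 1) : ℝ)⁻¹) +
          ∑ j ∈ Finset.range J, (nSeq (j + 1) : ℝ)) := by
        rw [← Finset.mul_sum, Finset.sum_add_distrib, ← Finset.mul_sum]
    _ ≤ C * (F.card * (1 / 8) + ∑ j ∈ Finset.range J, (nSeq (j + 1) : ℝ)) := by
        gcongr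
        exact sum_inv_mSeq_succ_le J
    _ = _ := by ring

/-- The weights with index below `J` each split few blocks, while those beyond `J` act through the
`ℓ_2`-sequence of their norms. -/
theorem CoeffsLeOne.normingSeminorm_l2Combinations_sum_le (hb : CoeffsLeOne K)
    (hl2 : ClosedUnderL2Combinations K) (hw : IsBlockSequence w)
    (hC : ∀ k, normingSeminorm K (w k) ≤ C) {F : Finset ℕ} {J : ℕ} {D : ℝ} (hD : 0 ≤ D)
    (htail : ∀ S : Finset ℕ, (∀ j ∈ S, J ≤ j) →
      ∑ j ∈ S, (∑ k ∈ F, normingSeminorm (weightedFunctionals K j) (w k)) ^ 2 ≤ D ^ 2) :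
    normingSeminorm (l2Combinations K) (∑ k ∈ F, w k) ≤
      C * (F.card / 8 + ∑ j ∈ Finset.range J, (nSeq (j + 1) : ℝ)) + D := by
  have hC0 : 0 ≤ C := (apply_nonneg _ _).trans (hC 0)
  refine (hb.mono hl2.l2Combinations_subset).normingSeminorm_le (by positivity) ?_
  rintro _ ⟨S, f, c, hf, hc, rfl⟩
  have hc : ∑ j ∈ S, |(c j : ℝ)| ^ 2 ≤ 1 := by
    simp only [sq_abs]
    exact_mod_cast hc
  set u : ℕ → ℝ := fun j => ∑ k ∈ F, |pairing (f j) (w k)|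
  have hu0 : ∀ j, 0 ≤ u j := fun j => Finset.sum_nonneg fun _ _ => abs_nonneg _
  have hlow : ∑ j ∈ S.filter (· < J), |(c j : ℝ)| * u j ≤
      C * (F.card / 8 + ∑ j ∈ Finset.range J, (nSeq (j + 1) : ℝ)) := by
    refine le_trans (Finset.sum_le_sum fun j hj => mul_le_of_le_one_left (hu0 j) ?_)
      (hb.sum_low_weights_le hw hC F (fun j hj => Finset.mem_range.2 (Finset.mem_filter.1 hj).2)
        fun j hj => hf j (Finset.mem_filter.1 hj).1)
    refine (sq_le_one_iff₀ (abs_nonneg _)).1 (le_trans ?_ hc)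
    exact Finset.single_le_sum (f := fun j => |(c j : ℝ)| ^ 2) (fun _ _ => sq_nonneg _)
      (Finset.mem_filter.1 hj).1
  have hhigh : ∑ j ∈ S.filter (¬ · < J), |(c j : ℝ)| * u j ≤ 1 * D := by
    refine sum_mul_le_of_sum_sq_le zero_le_one hD ?_ (le_trans ?_
      (htail (S.filter (¬ · < J)) fun j hj => not_lt.1 (Finset.mem_filter.1 hj).2))
    · rw [one_pow]
      exact (Finset.sum_le_sum_of_subset_of_nonneg (Finset.filter_subset _ _)
        fun _ _ _ => sq_nonneg _).trans hc
    · refine Finset.sum_le_sum fun j hj => pow_le_pow_left₀ (hu0 j) ?_ 2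
      exact Finset.sum_le_sum fun k _ => (hb.mono (weightedFunctionals_subset K j)
        ).abs_pairing_le_normingSeminorm (hf j (Finset.mem_filter.1 hj).1) _
  calc |pairing (∑ j ∈ S, (c j : ℝ) • f j) (∑ k ∈ F, w k)|
      ≤ ∑ j ∈ S, |(c j : ℝ)| * u j := by
        rw [pairing_sum_smul]
        refine (Finset.abs_sum_le_sum_abs _ _).trans (Finset.sum_le_sum fun j _ => ?_)
        rw [abs_mul, map_sum]
        exact mul_le_mul_of_nonneg_left (Finset.abs_sum_le_sum_abs _ _) (abs_nonneg _)
    _ ≤ _ := by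
        rw [← Finset.sum_filter_add_sum_filter_not S (· < J)]
        linarith

theorem IsExtension.normingSeminorm_sum_le (hK : IsExtension G K) (hGI : ClosedUnderIntervals G)
    (hb : CoeffsLeOne K) (hw : IsBlockSequence w) (hwK : ∀ k, normingSeminorm K (w k) ≤ C)
    (hwG : ∀ k, normingSeminorm G (w k) ≤ C / 2) {J : ℕ}
    (horth : ∀ k l, k < l → ∀ S : Finset ℕ, (∀ j ∈ S, J ≤ j) →
      ∑ j ∈ S, normingSeminorm (weightedFunctionals K j) (w k) *
        normingSeminorm (weightedFunctionals K j) (w l) ≤ C ^ 2 / 64)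
    {F : Finset ℕ} (hF : 8 * ∑ j ∈ Finset.range J, (nSeq (j + 1) : ℝ) + 22 ≤ F.card) :
    normingSeminorm K (∑ k ∈ F, w k) ≤ F.card * (C / 2) := by
  have hC : 0 ≤ C := (apply_nonneg _ _).trans (hwK 0)
  have hF22 : (22 : ℝ) ≤ F.card := le_trans (le_add_of_nonneg_left (by positivity)) hF
  have htail : ∀ S : Finset ℕ, (∀ j ∈ S, J ≤ j) →
      ∑ j ∈ S, (∑ k ∈ F, normingSeminorm (weightedFunctionals K j) (w k)) ^ 2 ≤
        (F.card * (C / 4)) ^ 2 := fun S hS =>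
    calc ∑ j ∈ S, (∑ k ∈ F, normingSeminorm (weightedFunctionals K j) (w k)) ^ 2
        ≤ F.card * C ^ 2 + (F.card : ℝ) ^ 2 * (C ^ 2 / 64) :=
          sum_sq_sum_le (fun k => hb.sum_sq_normingSeminorm_weightedFunctionals_le hK.l2 S (hwK k))
            (by positivity) fun k l hkl => horth k l hkl S hS
      _ ≤ (F.card * (C / 4)) ^ 2 := by
          nlinarith [mul_nonneg (mul_nonneg (Nat.cast_nonneg (α := ℝ) F.card) (sq_nonneg C))
            (sub_nonneg.2 hF22)]
  refine (hK.normingSeminorm_le_max hGI hb _).trans (max_le ?_ ?_)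
  · rw [← nsmul_eq_mul]
    exact (Finset.le_sum_of_subadditive _ (map_zero _).le (map_add_le_add _) _ _).trans
      (Finset.sum_le_card_nsmul _ _ _ fun k _ => hwG k)
  · calc normingSeminorm (l2Combinations K) (∑ k ∈ F, w k)
        ≤ C * (F.card / 8 + ∑ j ∈ Finset.range J, (nSeq (j + 1) : ℝ)) + F.card * (C / 4) :=
          hb.normingSeminorm_l2Combinations_sum_le hK.l2 hw hwK (by positivity) htail
      _ ≤ C * (F.card / 8 + F.card / 8) + F.card * (C / 4) := by
          gcongr
          linarith
      _ = F.card * (C / 2) := by ring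

theorem IsExtension.exists_average_le (hK : IsExtension G K) (hGI : ClosedUnderIntervals G)
    (hb : CoeffsLeOne K) (hw : IsBlockSequence w) (hC : 0 < C)
    (hwK : ∀ k, normingSeminorm K (w k) ≤ C) (hwG : ∀ k, normingSeminorm G (w k) ≤ C / 2) :
    ∃ n : ℕ, ∀ N : ℕ, ∃ v ∈ ellOneCombinations w n N, normingSeminorm K v ≤ C / 2 := by
  obtain ⟨J, κ, hκ, horth⟩ := exists_strictMono_sum_mul_le hC
    (fun k S => hb.sum_sq_normingSeminorm_weightedFunctionals_le hK.l2 S (hwK k))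
    (η := C ^ 2 / 64) (by positivity)
  set n := 8 * ∑ j ∈ Finset.range J, nSeq (j + 1) + 22 with hn
  have hn0 : (0 : ℝ) < n := by exact_mod_cast Nat.succ_pos _
  refine ⟨n, fun N => ?_⟩
  have hcard : (Finset.Ico N (N + n)).card = n := by rw [Nat.card_Ico, Nat.add_sub_cancel_left]
  have hsum := hK.normingSeminorm_sum_le hGI hb (w := fun k => w (κ k))
    (fun k l hkl => hw _ _ (hκ hkl)) (fun k => hwK _) (fun k => hwG _) horth
    (F := Finset.Ico N (N + n)) (by rw [hcard, hn]; push_cast; rfl)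
  refine ⟨∑ k ∈ Finset.Ico N (N + n), (n : ℝ)⁻¹ • w (κ k), ?_, ?_⟩
  · have hmem := sum_smul_comp_mem_ellOneCombinations (w := w) hκ.injective
      (F := Finset.Ico N (N + n)) (a := fun _ => (n : ℝ)⁻¹)
      (fun k hk => (Finset.mem_Ico.1 hk).1.trans (hκ.id_le k)) (by
        rw [Finset.sum_const, hcard, nsmul_eq_mul, abs_of_pos (inv_pos.2 hn0),
          mul_inv_cancel₀ hn0.ne'])
    rwa [hcard] at hmem
  · rw [← Finset.smul_sum, map_smul_eq_mul, Real.norm_of_nonneg (inv_nonneg.2 hn0.le),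
      inv_mul_le_iff₀ hn0]
    rwa [hcard] at hsum

end Averages

/-! ### Exclusion of `ℓ_1` -/

section EllOne

variable {G K : Set (ℕ →₀ ℝ)} {w : ℕ → ℕ →₀ ℝ} {c C : ℝ}

theorem LowerEllOne.exists_half (hl : LowerEllOne (normingSeminorm K) c w) (hK : IsExtension G K)
    (hGI : ClosedUnderIntervals G) (hb : CoeffsLeOne K)
    (hX : ¬ AdmitsEllSpreadingModel (NormingSpace G) 1) (hw : IsBlockSequence w) (hC : 0 < C)
    (hwK : ∀ k, normingSeminorm K (w k) ≤ C) :
    ∃ v, IsBlockSequence v ∧ LowerEllOne (normingSeminorm K) c v ∧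
      ∀ k, normingSeminorm K (v k) ≤ C / 2 := by
  obtain ⟨n, hn⟩ := exists_mem_ellOneCombinations_lt (hb.mono hK.subset) hGI hX hw (half_pos hC)
    fun k => (hb.normingSeminorm_mono hK.subset (w k)).trans (hwK k)
  obtain ⟨u, hu, hul, huC⟩ := hl.exists_blocks hw
    (Q := {v | normingSeminorm K v ≤ C ∧ normingSeminorm G v ≤ C / 2}) fun N =>
      (hn N).imp fun v hv => ⟨hv.1, apply_le_of_mem_ellOneCombinations hwK hv.1, hv.2.le⟩
  obtain ⟨m, hm⟩ :=
    hK.exists_average_le hGI hb hu hC (fun k => (huC k).1) fun k => (huC k).2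
  exact hul.exists_blocks hu hm

theorem IsExtension.not_lowerEllOne (hK : IsExtension G K) (hGI : ClosedUnderIntervals G)
    (hb : CoeffsLeOne K) (hX : ¬ AdmitsEllSpreadingModel (NormingSpace G) 1)
    (hw : IsBlockSequence w) (hwK : ∀ k, normingSeminorm K (w k) ≤ C) (hc : 0 < c) :
    ¬ LowerEllOne (normingSeminorm K) c w := by
  intro hl
  have hC : 0 < C := hc.trans_le ((hl.le_apply 0).trans (hwK 0))
  have hiter : ∀ r : ℕ, ∃ v, IsBlockSequence v ∧ LowerEllOne (normingSeminorm K) c v ∧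
      ∀ k, normingSeminorm K (v k) ≤ C * (1 / 2) ^ r := by
    intro r
    induction r with
    | zero => exact ⟨w, hw, hl, by simpa using hwK⟩
    | succ r ih =>
      obtain ⟨v, hv, hvl, hvC⟩ := ih
      rw [pow_succ, ← mul_assoc, mul_one_div]
      exact hvl.exists_half hK hGI hb hX hv (by positivity) hvC
  obtain ⟨r, hr⟩ := exists_pow_lt_of_lt_one (div_pos hc hC) one_half_lt_one
  obtain ⟨v, -, hvl, hvC⟩ := hiter r
  exact ((hvl.le_apply 0).trans (hvC 0)).not_gt ((lt_div_iff₀' hC).1 hr)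

theorem IsExtension.not_generatesSpreadingModel_one (hK : IsExtension G K)
    (hGI : ClosedUnderIntervals G) (hb : CoeffsLeOne K)
    (hbasis : ∀ n, Finsupp.single n 1 ∈ K) (hX : ¬ AdmitsEllSpreadingModel (NormingSpace G) 1)
    (x : ℕ → NormingSpace K) : ¬ GeneratesSpreadingModel 1 x := by
  intro hx
  obtain ⟨c, hc, hc1, hl⟩ := hx.exists_lowerEllOne
  obtain ⟨i, i', w, hi, hw, hnear⟩ :=
    exists_blockSequence_near_differences hb hbasis (fun k => (hx.1 k).le) hc
  have hwl : LowerEllOne (normingSeminorm K) (2 * c - c) w :=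
    lowerEllOne_normingSeminorm_iff.2 ((hl.sub_of_interlacing hi).of_near hnear)
  refine hK.not_lowerEllOne hGI hb hX hw (C := 3) (fun k => ?_) (by linarith) hwl
  have hdiff : ‖x (i k) - x (i' k)‖ ≤ 2 := by
    linarith [norm_sub_le (x (i k)) (x (i' k)), hx.1 (i k), hx.1 (i' k)]
  rw [← norm_toNormingSpace]
  linarith [norm_le_norm_add_norm_sub' (toNormingSpace K (w k)) (x (i k) - x (i' k)), hnear k]

end EllOne

theorem theorem11p3_general {G D : Set (ℕ →₀ ℝ)} (hGI : ClosedUnderIntervals G)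
    (hb : CoeffsLeOne D) (hbasis : ∀ n, Finsupp.single n 1 ∈ D)
    (hX : ¬ AdmitsEllSpreadingModel (NormingSpace G) 1) (hD : IsExtension G D) {p : ENNReal}
    (hp : 1 ≤ p) : ¬ AdmitsEllSpreadingModel (NormingSpace D) p := by
  rintro ⟨x, hx⟩
  rcases hp.eq_or_lt with rfl | hp
  · exact hD.not_generatesSpreadingModel_one hGI hb hbasis hX x hx
  · exact not_generatesSpreadingModel_of_one_lt hb hbasis hD.symm hD.interval
      hD.isFullyClosed.operation hp x hx

end SpreadingModels

end

open SpreadingModels in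
theorem theorem11p3 (G : Set (ℕ →₀ ℝ)) (hG : IsGroundSet G)
    (hX : ¬ AdmitsEllSpreadingModel (NormingSpace G) 1)
    (D : Set (ℕ →₀ ℝ)) (hD : IsExtension G D) :
    (∀ p : ENNReal, 1 ≤ p → p ≠ ⊤ → ¬ AdmitsEllSpreadingModel (NormingSpace D) p) ∧
      ¬ AdmitsC0SpreadingModel (NormingSpace D) := by
  have hexcl {p : ENNReal} (hp : 1 ≤ p) : ¬ AdmitsEllSpreadingModel (NormingSpace D) p :=
    theorem11p3_general hG.interval
      (fun f hf => hG.abs_le_one_of_mem_fullClosure f (hD.subset_fullClosure hf))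
      (fun n => hD.subset (hG.basis_mem n)) hX hD hp
  exact ⟨fun p hp _ => hexcl hp, hexcl le_top⟩
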